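/- A skew left brace $(G,\star,\circ)$ is a finite set $G$ with two group structures $(G,\star)$ and $(G,\circ)$ such that $g\circ(h\star k)=(g\circ h)\star g^{-1}\star(g\circ k)$ for all $g,h,k\in G$, where $g^{-1}$ is the inverse of $g$ in $(G,\star)$. A subgroup $G'$ of $(G,\star)$ is $\circ$-stable if $(g\circ g')\star g^{-1}\in G'$ for all $g\in G$ and $g'\in G'$. Let $L/K$ be a Galois extension of fields with Galois group $\Gamma$. For a cocommutative $K$-Hopf algebra $H$, an $H$-Hopf Galois structure on $L/K$ is an $H$-module algebra structure on $L$ for which the map $L\otimes_K H\to\mathrm{End}_K(L)$, $x\otimes h\mapsto(y\mapsto x\,h(y))$, is bijective. For a subgroup $N$ of $\mathrm{Perm}(\Gamma)$, such a structure corresponds to $N$ if there is an isomorphism of $L$-Hopf algebras $\varphi:L\otimes_K H\to L[N]$ under which the action of $L\otimes_K H$ on $L\otimes_K L$ becomes, via $L\otimes_K L\to\mathrm{Map}(\Gamma,L)$, $x\otimes y\mapsto(\gamma\mapsto x\gamma(y))$, the $L$-linear action of $L[N]$ on $\mathrm{Map}(\Gamma,L)$ given by $(\eta f)(\gamma)=f(\eta^{-1}(\gamma))$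 for $\eta\in N$. **Theorem 4.3.** Let $(G,\star,\circ)$ be a skew left brace, let $L/K$ be a Galois extension of fields with Galois group $\Gamma$, and let $a:(G,\circ)\to\Gamma$ be an isomorphism of groups. Let $\alpha:(G,\star)\to\mathrm{Perm}(\Gamma)$ be the injective homomorphism $\alpha(g)(\gamma)=a(g\star a^{-1}(\gamma))$. Then: 1. There is a cocommutative $K$-Hopf algebra $H$ and an $H$-Hopf Galois structure on $L/K$ that corresponds to $N=\alpha(G)\cong(G,\star)$. 2. It is unique up to isomorphism: if an $H_1$- and an $H_2$-Hopf Galois structure on $L/K$ both correspond to $\alpha(G)$, then there is an isomorphism of $K$-Hopf algebras $H_1\to H_2$ that is compatible with the actions on $L$. 3. For every $H$-Hopf Galois structure on $L/K$ that corresponds to $\alpha(G)$, and every $\varphi:L\otimes_K H\to L[\alpha(G)]$ as above, there is a bijection $J\mapsto G'$ from the $K$-sub-Hopf algebras of $H$ to the $\circ$-stable subgroups of $(G,\star)$ such that $\varphi(L\otimes_K J)=L[\alpha(G')]$ for all $J$. -/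

import Mathlib

open scoped TensorProduct

universe u v w x y

/-- A skew left brace `(G, ⋆, ∘)`.  The additive group `(G, ⋆)` is the `Group` structure of `G`,
written `*` and `⁻¹`; the second group structure `(G, ∘)` is the field `circGroup`. -/
class SkewLeftBrace (G : Type*) extends Group G where
  /-- The group structure `(G, ∘)`. -/
  circGroup : Group G
  /-- `g ∘ (h ⋆ k) = (g ∘ h) ⋆ g⁻¹ ⋆ (g ∘ k)`, with `g⁻¹` the inverse in `(G, ⋆)`. -/
  circ_mul (g h k : G) :
    circGroup.mul g (h * k) = circGroup.mul g h * g⁻¹ * circGroup.mul g k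

namespace SkewLeftBrace

/-- The operation `g ∘ h`. -/
def circ {G : Type*} [SkewLeftBrace G] (g h : G) : G := (circGroup : Group G).mul g h

/-- A copy of the set `G`, which carries the group structure `(G, ∘)`. -/
def Circ (G : Type*) : Type _ := G

/-- The identity map from `G` to its copy. -/
def toCirc (G : Type*) : G ≃ Circ G := Equiv.refl G

instance (G : Type*) [SkewLeftBrace G] : Group (Circ G) := (circGroup : Group G)

/-- A subgroup `G'` of `(G, ⋆)` is `∘`-stable if `(g ∘ g') ⋆ g⁻¹ ∈ G'` for all `g ∈ G` and
`g' ∈ G'`. -/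
def IsCircStable {G : Type*} [SkewLeftBrace G] (G' : Subgroup G) : Prop :=
  ∀ g g' : G, g' ∈ G' → circ g g' * g⁻¹ ∈ G'

/-- For `a : (G, ∘) → Γ` an isomorphism, the homomorphism `α : (G, ⋆) → Perm Γ`,
`α(g) = a λ_⋆(g) a⁻¹`, where `λ_⋆(g)` is left `⋆`-multiplication by `g`. -/
def alpha {G Γ : Type*} [SkewLeftBrace G] [Group Γ] (a : Circ G ≃* Γ) : G →* Equiv.Perm Γ :=
  (((toCirc G).trans a.toEquiv).permCongrHom : Equiv.Perm G →* Equiv.Perm Γ).comp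
    (MulAction.toPermHom G G)

end SkewLeftBrace

/-- A `K`-sub-Hopf algebra of `H`: a subalgebra `J` with `Δ(J) ⊆ J ⊗ J` (the image of `J ⊗ J`
in `H ⊗ H`) and `S(J) ⊆ J`. -/
@[ext]
structure SubHopfAlgebra (K : Type*) (H : Type*) [Field K] [Ring H] [HopfAlgebra K H] extends
    Subalgebra K H where
  comul_mem (h : H) : h ∈ carrier →
    (Coalgebra.comul h : H ⊗[K] H) ∈
      LinearMap.range (TensorProduct.map toSubalgebra.val.toLinearMap toSubalgebra.val.toLinearMap)
  antipode_mem (h : H) : h ∈ carrier → HopfAlgebra.antipode K h ∈ carrier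

section HopfGalois

variable (K : Type*) (L : Type*) [Field K] [Field L] [Algebra K L]

/-- An `H`-Hopf Galois structure on `L/K`: an action of `H` on `L` that makes `L` an `H`-module
algebra, such that `j : L ⊗ H → End_K(L)`, `j(x ⊗ h)(y) = x h(y)`, is bijective. -/
structure HopfGaloisStructure (H : Type*) [Ring H] [HopfAlgebra K H] where
  /-- The `H`-module structure on `L`, with `h(x) = action h x`. -/
  action : H →ₐ[K] Module.End K L
  /-- `h(1) = ε(h) 1`. -/
  action_one (h : H) : action h 1 = algebraMap K L (Coalgebra.counit h)
  /-- `h(x y) = ∑ h₁(x) h₂(y)`. -/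
  action_mul (h : H) (x y : L) :
    action h (x * y) = LinearMap.mul' K L
      (TensorProduct.map (action.toLinearMap.flip x) (action.toLinearMap.flip y)
        (Coalgebra.comul h))
  bijective : Function.Bijective
    (TensorProduct.lift ((LinearMap.mul K (Module.End K L)).compl₁₂
      (Algebra.lmul K L).toLinearMap action.toLinearMap) : L ⊗[K] H →ₗ[K] Module.End K L)

/-- The map `L ⊗ L → Map(Γ, L)`, `x ⊗ y ↦ (γ ↦ x γ(y))`, where `Γ = Gal(L/K)`. -/
noncomputable def galoisSplitting : L ⊗[K] L →ₐ[L] (Gal(L/K) → L) :=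
  Algebra.TensorProduct.lift (Algebra.ofId L (Gal(L/K) → L))
    (AlgHom.pi (A := fun _ : Gal(L/K) => L) fun γ => (γ : L →ₐ[K] L))
    (fun _ _ => Commute.all _ _)

/-- The action of `L[N]` on `Map(Γ, L)`, for a group `N` of permutations of `Γ`: it is `L`-linear,
and `η ∈ N` takes the indicator function of `γ` to that of `η(γ)`, that is,
`(η f)(γ) = f(η⁻¹(γ))`. -/
noncomputable def permAction {Γ : Type*} (N : Subgroup (Equiv.Perm Γ)) :
    MonoidAlgebra L N →ₐ[L] Module.End L (Γ → L) :=
  MonoidAlgebra.lift L (Module.End L (Γ → L)) N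
    { toFun := fun η => LinearMap.funLeft L L ⇑((η : Equiv.Perm Γ)⁻¹)
      map_one' := by ext; simp [LinearMap.funLeft]
      map_mul' := fun η θ => by ext; simp [LinearMap.funLeft] }

variable {K L}

namespace HopfGaloisStructure

variable {H : Type*} [Ring H] [HopfAlgebra K H] (S : HopfGaloisStructure K L H)

/-- The base change of the action: `L ⊗ H` acts on `L ⊗ L` by
`(l ⊗ h)(x ⊗ y) = l x ⊗ h(y)`. -/
noncomputable def baseChangeAction : L ⊗[K] H →ₐ[L] Module.End L (L ⊗[K] L) :=
  (LinearMap.tensorProductEnd K L L).comp (Algebra.TensorProduct.map (AlgHom.id L L) S.action)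

/-- The relation between Hopf Galois structures on `L/K` and groups `N` of permutations of
`Γ = Gal(L/K)`: an isomorphism of `L`-Hopf algebras `L ⊗ H ≅ L[N]`, under which the action of
`L ⊗ H` on `L ⊗ L` becomes the action of `L[N]` on `Map(Γ, L)` by permutations of `Γ`. -/
structure Correspondence (N : Subgroup (Equiv.Perm Gal(L/K))) where
  /-- The isomorphism `L ⊗ H ≅ L[N]`. -/
  iso : L ⊗[K] H ≃ₐc[L] MonoidAlgebra L N
  compatible (z : L ⊗[K] H) (t : L ⊗[K] L) :
    galoisSplitting K L (S.baseChangeAction z t) =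
      permAction L N (iso z) (galoisSplitting K L t)

end HopfGaloisStructure

end HopfGalois

/-! Put `N = α(G)` and `Γ = Gal(L/K)`. The brace identity says that conjugating `α(g)` by left
translation by `a(h)` gives `α((h ∘ g) ⋆ h⁻¹)` (`translation_alpha`). So `Γ` acts on `N` by some
`ψ`, hence semilinearly on `L[N]`. Galois descent makes the fixed algebra a `K`-form of the Hopf
algebra `L[N]` (`nonempty_hopfDescentData`). It acts on `L`, embedded in `Map(Γ, L)` as the
functions `γ ↦ γ(y)`; evaluated at `1`, `∑ l_η η` becomes `y ↦ ∑ l_η η⁻¹(1)(y)`. Since `N` is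
regular, `η⁻¹(1)` meets each element of `Γ` once, so Dedekind independence and dual bases identify
`L[N]` with `End_K(L)`. This is existence.

For uniqueness, a corresponding `H` embeds in `L[N]`, and its image is exactly the fixed algebra
(`range_embedding`), while the action on `L` can be read off from the embedding.

For the bijection, the `L`-span of a sub-Hopf algebra `J` is a sub-Hopf algebra of `L[N]`, hence
`L[M]` for a subgroup `M` (`spanImage_eq`), and `M` is `ψ`-stable because `J` is fixed. Conversely
descent recovers `J` from a stable `M` (`exists_spanImage_eq`). By the conjugation formula,
`ψ`-stable means `∘`-stable. -/

/-! ### Tensor products of `K`-forms. -/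

section TensorForm

variable {K L V W U A B C : Type*} [Field K] [Field L] [Algebra K L]
  [AddCommGroup V] [Module K V] [AddCommGroup W] [Module K W] [AddCommGroup U] [Module K U]
  [AddCommGroup A] [Module K A] [Module L A] [IsScalarTower K L A]
  [AddCommGroup B] [Module K B] [Module L B] [IsScalarTower K L B]
  [AddCommGroup C] [Module K C] [Module L C] [IsScalarTower K L C]

variable (L) in
/-- The map `V ⊗[K] W → A ⊗[L] B` induced by `K`-linear maps `V → A` and `W → B`. -/
noncomputable def tensorForm (i : V →ₗ[K] A) (j : W →ₗ[K] B) : V ⊗[K] W →ₗ[K] A ⊗[L] B :=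
  (TensorProduct.mapOfCompatibleSMul L K K A B) ∘ₗ (TensorProduct.map i j)

@[simp]
lemma tensorForm_tmul (i : V →ₗ[K] A) (j : W →ₗ[K] B) (v : V) (w : W) :
    tensorForm L i j (v ⊗ₜ w) = i v ⊗ₜ j w := rfl

/-- Together with `IsBaseChange.injective`, this allows identities between tensors over `K` to be
checked over `L`. -/
lemma IsBaseChange.tensorForm {i : V →ₗ[K] A} {j : W →ₗ[K] B} (hi : IsBaseChange L i)
    (hj : IsBaseChange L j) : IsBaseChange L (tensorForm L i j) := by
  refine IsBaseChange.of_equiv ((TensorProduct.AlgebraTensorModule.distribBaseChange K L V W).trans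
    (TensorProduct.congr hi.equiv hj.equiv)) fun x => ?_
  induction x with
  | zero => simp
  | add x y hx hy => rw [TensorProduct.tmul_add, map_add, map_add, hx, hy]
  | tmul v w => simp [IsBaseChange.equiv_tmul]

lemma IsBaseChange.injective {i : V →ₗ[K] A} (hi : IsBaseChange L i) : Function.Injective i := by
  intro v w h
  rw [← one_smul L (i v), ← one_smul L (i w), ← hi.equiv_tmul, ← hi.equiv_tmul] at h
  exact Module.FaithfullyFlat.tensorProduct_mk_injective (A := K) (B := L) V (hi.equiv.injective h)

lemma tensorForm_map {V' W' : Type*} [AddCommGroup V'] [Module K V'] [AddCommGroup W']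
    [Module K W'] {A' B' : Type*} [AddCommGroup A'] [Module K A'] [Module L A']
    [IsScalarTower K L A'] [AddCommGroup B'] [Module K B'] [Module L B'] [IsScalarTower K L B']
    {i : V →ₗ[K] A} {j : W →ₗ[K] B} {i' : V' →ₗ[K] A'} {j' : W' →ₗ[K] B'}
    {f : V →ₗ[K] V'} {g : W →ₗ[K] W'} {F : A →ₗ[L] A'} {G : B →ₗ[L] B'}
    (hf : ∀ v, i' (f v) = F (i v)) (hg : ∀ w, j' (g w) = G (j w)) (t : V ⊗[K] W) :
    tensorForm L i' j' (TensorProduct.map f g t) =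
      TensorProduct.map F G (tensorForm L i j t) := by
  induction t with
  | zero => simp
  | add x y hx hy => simp only [map_add, hx, hy]
  | tmul v w => simp [hf, hg]

lemma tensorForm_comm (i : V →ₗ[K] A) (j : W →ₗ[K] B) (t : V ⊗[K] W) :
    tensorForm L j i (TensorProduct.comm K V W t) =
      TensorProduct.comm L A B (tensorForm L i j t) := by
  induction t with
  | zero => simp
  | add x y hx hy => simp only [map_add, hx, hy]
  | tmul v w => simp

lemma tensorForm_assoc (i : V →ₗ[K] A) (j : W →ₗ[K] B) (k : U →ₗ[K] C) (t : (V ⊗[K] W) ⊗[K] U) :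
    tensorForm L i (tensorForm L j k) (TensorProduct.assoc K V W U t) =
      TensorProduct.assoc L A B C (tensorForm L (tensorForm L i j) k t) := by
  induction t with
  | zero => simp
  | add x y hx hy => simp only [map_add, hx, hy]
  | tmul v w =>
    induction v with
    | zero => simp
    | add x y hx hy => simp only [map_add, TensorProduct.add_tmul, hx, hy]
    | tmul v w => simp

end TensorForm

/-! ### Forms of Hopf algebras. -/

section HopfForm

variable {K L H A : Type*} [Field K] [Field L] [Algebra K L] [Ring H] [Ring A]
  [Algebra K A]

lemma tensorForm_mul [Algebra L A] [IsScalarTower K L A] [Algebra K H] (i : H →ₐ[K] A)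
    (s t : H ⊗[K] H) :
    tensorForm L i.toLinearMap i.toLinearMap (s * t) =
      tensorForm L i.toLinearMap i.toLinearMap s * tensorForm L i.toLinearMap i.toLinearMap t := by
  induction s with
  | zero => simp
  | add x y hx hy => simp only [map_add, add_mul, hx, hy]
  | tmul v w =>
    induction t with
    | zero => simp
    | add x y hx hy => simp only [map_add, mul_add, hx, hy]
    | tmul v w => simp

lemma mul'_tensorForm [Algebra L A] [IsScalarTower K L A] [Algebra K H] (i : H →ₐ[K] A)
    (t : H ⊗[K] H) :
    i (LinearMap.mul' K H t) =
      LinearMap.mul' L A (tensorForm L i.toLinearMap i.toLinearMap t) := by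
  induction t with
  | zero => simp
  | add x y hx hy => simp only [map_add, hx, hy]
  | tmul v w => simp

/-- The base change of an algebra homomorphism `i : H → A` to an algebra over `L`. -/
noncomputable def AlgHom.baseChangeLift [Algebra K H] [Algebra L A] [IsScalarTower K L A]
    (i : H →ₐ[K] A) : L ⊗[K] H →ₐ[L] A :=
  Algebra.TensorProduct.lift (Algebra.ofId L A) i fun x y => by
    rw [Algebra.ofId_apply]
    exact Algebra.commutes x (i y)

@[simp]
lemma AlgHom.baseChangeLift_tmul [Algebra K H] [Algebra L A] [IsScalarTower K L A]
    (i : H →ₐ[K] A) (l : L) (x : H) : i.baseChangeLift (l ⊗ₜ[K] x) = l • i x := by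
  rw [AlgHom.baseChangeLift, Algebra.TensorProduct.lift_tmul, Algebra.ofId_apply, Algebra.smul_def]

lemma IsBaseChange.bijective_baseChangeLift [Algebra K H] [Algebra L A] [IsScalarTower K L A]
    {i : H →ₐ[K] A} (h : IsBaseChange L i.toLinearMap) :
    Function.Bijective (i.baseChangeLift (L := L)) := by
  convert h.equiv.bijective using 1
  ext t
  induction t with
  | zero => simp
  | add x y hx hy => simp only [map_add, hx, hy]
  | tmul v w => simp [h.equiv_tmul]

/-- Data that exhibit a `K`-algebra `H` as a `K`-form of the `L`-Hopf algebra `A`: the maps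
`comul`, `counit` and `antipode` of `A` restrict to `H`. -/
structure HopfDescentData (L : Type*) [Field L] [Algebra K L] [Algebra K H] [HopfAlgebra L A]
    [IsScalarTower K L A] (i : H →ₐ[K] A) where
  /-- The comultiplication of `H`. -/
  comul : H →ₗ[K] H ⊗[K] H
  /-- The counit of `H`. -/
  counit : H →ₗ[K] K
  /-- The antipode of `H`. -/
  antipode : H →ₗ[K] H
  isBaseChange : IsBaseChange L i.toLinearMap
  comul_spec (h : H) :
    tensorForm L i.toLinearMap i.toLinearMap (comul h) = Coalgebra.comul (R := L) (i h)
  counit_spec (h : H) : algebraMap K L (counit h) = Coalgebra.counit (R := L) (i h)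
  antipode_spec (h : H) : i (antipode h) = HopfAlgebra.antipode L (i h)

namespace HopfDescentData

variable [Algebra K H] [HopfAlgebra L A] [IsScalarTower K L A] {i : H →ₐ[K] A}
  (D : HopfDescentData L i)

include D

lemma injective : Function.Injective i := D.isBaseChange.injective

lemma tensorForm_injective :
    Function.Injective (tensorForm L i.toLinearMap i.toLinearMap) :=
  (D.isBaseChange.tensorForm D.isBaseChange).injective

/-- The Hopf algebra structure on a `K`-form of an `L`-Hopf algebra. -/
@[reducible]
noncomputable def hopfAlgebra : HopfAlgebra K H :=
  letI : Coalgebra K H :=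
    { comul := D.comul
      counit := D.counit
      coassoc := by
        ext h
        -- As for the axioms below, the identity is pushed along an injective map to tensors over
        -- `L`, where it is an axiom of `A`.
        apply (D.isBaseChange.tensorForm (D.isBaseChange.tensorForm D.isBaseChange)).injective
        simp only [LinearMap.comp_apply, LinearEquiv.coe_coe]
        rw [tensorForm_assoc, LinearMap.rTensor,
          tensorForm_map (F := Coalgebra.comul (R := L)) (G := LinearMap.id)
            (i := i.toLinearMap) (j := i.toLinearMap) D.comul_spec (fun _ => rfl),
          D.comul_spec, LinearMap.lTensor,
          tensorForm_map (F := LinearMap.id) (G := Coalgebra.comul (R := L))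
            (i := i.toLinearMap) (j := i.toLinearMap) (fun _ => rfl) D.comul_spec,
          D.comul_spec]
        exact Coalgebra.coassoc_apply (R := L) (i h)
      rTensor_counit_comp_comul := by
        ext h
        apply ((IsBaseChange.linearMap K L).tensorForm D.isBaseChange).injective
        simp only [LinearMap.comp_apply]
        rw [LinearMap.rTensor,
          tensorForm_map (F := Coalgebra.counit (R := L)) (G := LinearMap.id)
            (i := i.toLinearMap) (j := i.toLinearMap) D.counit_spec (fun _ => rfl), D.comul_spec]
        refine (Coalgebra.rTensor_counit_comul (R := L) (i h)).trans ?_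
        simp
      lTensor_counit_comp_comul := by
        ext h
        apply (D.isBaseChange.tensorForm (IsBaseChange.linearMap K L)).injective
        simp only [LinearMap.comp_apply]
        rw [LinearMap.lTensor,
          tensorForm_map (F := LinearMap.id) (G := Coalgebra.counit (R := L))
            (i := i.toLinearMap) (j := i.toLinearMap) (fun _ => rfl) D.counit_spec, D.comul_spec]
        refine (Coalgebra.lTensor_counit_comul (R := L) (i h)).trans ?_
        simp }
  letI : Bialgebra K H := Bialgebra.mk' K H
    (by
      apply (algebraMap K L).injective
      change algebraMap K L (D.counit 1) = _
      rw [D.counit_spec, map_one i, (algebraMap K L).map_one, Bialgebra.counit_one])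
    (by
      intro a b
      apply (algebraMap K L).injective
      change algebraMap K L (D.counit (a * b)) = algebraMap K L (D.counit a * D.counit b)
      rw [(algebraMap K L).map_mul, D.counit_spec, D.counit_spec, D.counit_spec, map_mul i,
        Bialgebra.counit_mul])
    (by
      apply D.tensorForm_injective
      change tensorForm L _ _ (D.comul 1) = _
      rw [D.comul_spec, map_one, Bialgebra.comul_one, Algebra.TensorProduct.one_def,
        Algebra.TensorProduct.one_def]
      simp)
    (by
      intro a b
      apply D.tensorForm_injective
      change tensorForm L _ _ (D.comul (a * b)) = tensorForm L _ _ (D.comul a * D.comul b)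
      rw [tensorForm_mul, D.comul_spec, D.comul_spec, D.comul_spec, map_mul, Bialgebra.comul_mul])
  { antipode := D.antipode
    mul_antipode_rTensor_comul := by
      ext h
      apply D.injective
      change i (LinearMap.mul' K H (TensorProduct.map D.antipode LinearMap.id (D.comul h))) =
        i (algebraMap K H (D.counit h))
      rw [mul'_tensorForm (L := L),
        tensorForm_map (F := HopfAlgebra.antipode L) (G := LinearMap.id)
          (i := i.toLinearMap) (j := i.toLinearMap) D.antipode_spec (fun _ => rfl), D.comul_spec]
      refine (HopfAlgebra.mul_antipode_rTensor_comul_apply (R := L) (i h)).trans ?_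
      rw [← D.counit_spec, AlgHom.commutes, ← IsScalarTower.algebraMap_apply]
    mul_antipode_lTensor_comul := by
      ext h
      apply D.injective
      change i (LinearMap.mul' K H (TensorProduct.map LinearMap.id D.antipode (D.comul h))) =
        i (algebraMap K H (D.counit h))
      rw [mul'_tensorForm (L := L),
        tensorForm_map (F := LinearMap.id) (G := HopfAlgebra.antipode L)
          (i := i.toLinearMap) (j := i.toLinearMap) (fun _ => rfl) D.antipode_spec, D.comul_spec]
      refine (HopfAlgebra.mul_antipode_lTensor_comul_apply (R := L) (i h)).trans ?_
      rw [← D.counit_spec, AlgHom.commutes, ← IsScalarTower.algebraMap_apply] }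

end HopfDescentData

/-- An algebra homomorphism `i : H → A` from a `K`-Hopf algebra to an `L`-Hopf algebra that
exhibits `A` as the base change of the bialgebra `H`. -/
structure IsHopfForm (L : Type*) [Field L] [Algebra K L] [HopfAlgebra K H] [HopfAlgebra L A]
    [IsScalarTower K L A] (i : H →ₐ[K] A) : Prop where
  isBaseChange : IsBaseChange L i.toLinearMap
  comul_spec (h : H) :
    tensorForm L i.toLinearMap i.toLinearMap (Coalgebra.comul h) = Coalgebra.comul (R := L) (i h)
  counit_spec (h : H) : algebraMap K L (Coalgebra.counit h) = Coalgebra.counit (R := L) (i h)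

lemma HopfDescentData.isHopfForm [Algebra K H] [HopfAlgebra L A] [IsScalarTower K L A]
    {i : H →ₐ[K] A} (D : HopfDescentData L i) :
    letI := D.hopfAlgebra
    IsHopfForm L i :=
  letI := D.hopfAlgebra
  ⟨D.isBaseChange, D.comul_spec, D.counit_spec⟩

/-- In the convolution algebra `Hom(A, B)`, `f ∘ S` is a left inverse of `f` and `S ∘ f` is a right
inverse, so they agree. -/
lemma BialgHom.map_antipode {R A B : Type*} [CommRing R] [Ring A] [Ring B] [HopfAlgebra R A]
    [HopfAlgebra R B] (f : A →ₐc[R] B) (x : A) :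
    f (HopfAlgebra.antipode R x) = HopfAlgebra.antipode R (f x) := by
  let F : A →ₗ[R] B := (f : A →ₐ[R] B).toLinearMap
  have hmap (t : A ⊗[R] A) : F (LinearMap.mul' R A t) =
      LinearMap.mul' R B (TensorProduct.map F F t) := by
    induction t with
    | zero => simp
    | add x y hx hy => simp only [map_add, hx, hy]
    | tmul x y => simp [F]
  have hcomul (y : A) : TensorProduct.map F F (Coalgebra.comul y) = Coalgebra.comul (F y) :=
    CoalgHomClass.map_comp_comul_apply f y
  have hcounit (y : A) : Coalgebra.counit (R := R) (F y) = Coalgebra.counit (R := R) y :=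
    CoalgHomClass.counit_comp_apply f y
  have h₁ : WithConv.toConv (F ∘ₗ HopfAlgebra.antipode R) * WithConv.toConv F = 1 := by
    ext y
    have h := congrArg F (HopfAlgebra.mul_antipode_rTensor_comul_apply (R := R) y)
    rw [hmap, LinearMap.rTensor, ← LinearMap.comp_apply (TensorProduct.map F F),
      ← TensorProduct.map_comp] at h
    refine h.trans ?_
    simp [F]
  have h₂ : WithConv.toConv F * WithConv.toConv (HopfAlgebra.antipode R ∘ₗ F) = 1 := by
    ext y
    have h := HopfAlgebra.mul_antipode_lTensor_comul_apply (R := R) (F y)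
    rw [← hcomul, LinearMap.lTensor, ← LinearMap.comp_apply (TensorProduct.map _ _),
      ← TensorProduct.map_comp, hcounit] at h
    refine h.trans ?_
    simp
  exact congrArg (fun g => g.ofConv x) (left_inv_eq_right_inv h₁ h₂)

lemma TensorProduct.comul_one_tmul [HopfAlgebra K H] (h : H) :
    Coalgebra.comul (R := L) ((1 : L) ⊗ₜ[K] h) =
      tensorForm L (TensorProduct.mk K L H 1) (TensorProduct.mk K L H 1) (Coalgebra.comul h) := by
  rw [TensorProduct.comul_tmul, CommSemiring.comul_apply]
  generalize Coalgebra.comul (R := K) h = t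
  induction t with
  | zero => simp
  | add x y hx hy => simp only [map_add, TensorProduct.tmul_add, hx, hy]
  | tmul v w => simp

namespace IsHopfForm

variable [HopfAlgebra K H] [HopfAlgebra L A] [IsScalarTower K L A]

/-- The base change of a bialgebra is isomorphic to any of its forms. -/
noncomputable def baseChangeEquiv {i : H →ₐ[K] A} (h : IsHopfForm L i) : L ⊗[K] H ≃ₐc[L] A :=
  BialgEquiv.ofAlgEquiv
    (AlgEquiv.ofBijective i.baseChangeLift h.isBaseChange.bijective_baseChangeLift)
    (by
      refine Algebra.TensorProduct.ext (by ext) (AlgHom.ext fun x => ?_)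
      change Coalgebra.counit (R := L) (i.baseChangeLift ((1 : L) ⊗ₜ x)) =
        Coalgebra.counit (R := L) ((1 : L) ⊗ₜ[K] x)
      simp [← h.counit_spec, Algebra.algebraMap_eq_smul_one])
    (by
      refine Algebra.TensorProduct.ext (by ext) (AlgHom.ext fun x => ?_)
      change TensorProduct.map i.baseChangeLift.toLinearMap i.baseChangeLift.toLinearMap
        (Coalgebra.comul (R := L) ((1 : L) ⊗ₜ[K] x)) =
          Coalgebra.comul (R := L) (i.baseChangeLift ((1 : L) ⊗ₜ x))
      rw [AlgHom.baseChangeLift_tmul, one_smul, ← h.comul_spec, TensorProduct.comul_one_tmul]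
      generalize Coalgebra.comul (R := K) x = t
      induction t with
      | zero => simp
      | add x y hx hy => simp only [map_add, hx, hy]
      | tmul v w => simp)

@[simp]
lemma baseChangeEquiv_tmul {i : H →ₐ[K] A} (h : IsHopfForm L i) (l : L) (x : H) :
    h.baseChangeEquiv (l ⊗ₜ x) = l • i x :=
  AlgHom.baseChangeLift_tmul i l x

lemma of_equiv (e : L ⊗[K] H ≃ₐc[L] A) {i : H →ₐ[K] A} (hi : ∀ x, i x = e (1 ⊗ₜ x)) :
    IsHopfForm L i where
  isBaseChange := IsBaseChange.of_equiv (e : L ⊗[K] H ≃ₐ[L] A).toLinearEquiv fun x => (hi x).symm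
  comul_spec x := by
    rw [hi, ← CoalgHomClass.map_comp_comul_apply, TensorProduct.comul_one_tmul]
    generalize Coalgebra.comul (R := K) x = t
    induction t with
    | zero => simp
    | add x y hx hy => simp only [map_add, hx, hy]
    | tmul v w => simp [hi]
  counit_spec x := by
    rw [hi, CoalgHomClass.counit_comp_apply]
    simp [Algebra.algebraMap_eq_smul_one]

/-- This is why `IsHopfForm` needs no condition on antipodes: the bialgebra isomorphism
`baseChangeEquiv` preserves them. -/
lemma map_antipode {i : H →ₐ[K] A} (h : IsHopfForm L i) (x : H) :
    i (HopfAlgebra.antipode K x) = HopfAlgebra.antipode L (i x) := by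
  have := BialgHom.map_antipode (h.baseChangeEquiv : L ⊗[K] H →ₐc[L] A) (1 ⊗ₜ x)
  simpa using this

end IsHopfForm

end HopfForm

/-! ### Galois descent for vector spaces. -/

section GaloisDescent

variable {K L : Type*} [Field K] [Field L] [Algebra K L] [FiniteDimensional K L]

open Classical in
variable (K L) in
/-- Coordinates for Galois descent, which come from a pair of trace dual bases. -/
lemma exists_galois_coordinates [IsGalois K L] : ∃ (n : ℕ) (e d : Fin n → L), ∀ σ : Gal(L/K),
    ∑ i, e i * σ (d i) = if σ = 1 then 1 else 0 := by
  let b := Module.finBasis K L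
  refine ⟨_, b, b.traceDual, fun σ => ?_⟩
  have hinj : Function.Injective (fun σ : Gal(L/K) => ((σ : L →* L))) := fun σ τ h =>
    AlgEquiv.ext fun x => DFunLike.congr_fun h x
  have hli := (linearIndependent_monoidHom L L).comp _ hinj
  rw [Fintype.linearIndependent_iff] at hli
  -- By Dedekind independence it suffices that `∑ σ, (∑ i, b i * σ (b.traceDual i)) * σ x = x`,
  -- which is the expansion of `x` in the basis `b`.
  have := hli (fun σ => (∑ i, b i * σ (b.traceDual i)) - if σ = 1 then 1 else 0) ?_ σ
  · exact sub_eq_zero.mp this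
  ext x
  have hx : x = ∑ i, algebraMap K L (Algebra.trace K L (x * b.traceDual i)) * b i := by
    conv_lhs => rw [← b.sum_repr x]
    refine Finset.sum_congr rfl fun i _ => ?_
    have := b.traceDual.traceDual_repr_apply x i
    rw [b.traceDual_traceDual, Algebra.traceForm_apply] at this
    rw [this, Algebra.smul_def]
  simp only [Finset.sum_apply, Pi.smul_apply, Function.comp_apply, smul_eq_mul, sub_mul,
    Finset.sum_sub_distrib, ite_mul, zero_mul, one_mul, Finset.sum_ite_eq', Finset.mem_univ,
    if_true, Pi.zero_apply]
  rw [sub_eq_zero]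
  change _ = x
  conv_rhs => rw [hx]
  simp only [trace_eq_sum_automorphisms, Finset.sum_mul]
  rw [Finset.sum_comm]
  refine Finset.sum_congr rfl fun i _ => Finset.sum_congr rfl fun τ _ => ?_
  change b i * τ (b.traceDual i) * τ x = _
  rw [map_mul]
  ring

variable {V : Type*} [AddCommGroup V] [Module K V] [Module L V]
  {W : Type*} [AddCommGroup W] [Module K W]
  (ρ : Gal(L/K) →* Module.End K V) (hρ : ∀ σ (l : L) v, ρ σ (l • v) = σ l • ρ σ v)

include hρ

open Classical in
/-- A vector of a semilinear representation of the Galois group is a combination of traces. -/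
lemma eq_sum_smul_trace {n : ℕ} {e d : Fin n → L}
    (hed : ∀ σ : Gal(L/K), ∑ i, e i * σ (d i) = if σ = 1 then 1 else 0) (v : V) :
    v = ∑ i, e i • ∑ σ, ρ σ (d i • v) := by
  simp only [hρ, Finset.smul_sum, smul_smul]
  rw [Finset.sum_comm]
  simp only [← Finset.sum_smul, hed]
  simp

/-- Galois descent: a vector space over `L` with a semilinear action of the Galois group is the base
change of the space of invariants. -/
lemma isBaseChange_of_range_eq_invariants [IsGalois K L] [IsScalarTower K L V] (i : W →ₗ[K] V)
    (hi : Function.Injective i) (hr : ∀ v, v ∈ LinearMap.range i ↔ ∀ σ, ρ σ v = v) : IsBaseChange L i := by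
  classical
  obtain ⟨n, e, d, hed⟩ := exists_galois_coordinates K L
  have hT (v : V) : ∃ w, i w = ∑ σ, ρ σ v := (hr _).2 fun τ => by
    rw [map_sum]
    refine Fintype.sum_equiv (Equiv.mulLeft τ) _ _ fun σ => ?_
    simp
  choose T hT using hT
  let f : L ⊗[K] W →ₗ[L] V := TensorProduct.AlgebraTensorModule.lift
    { toFun := fun l => l • i
      map_add' := fun _ _ => add_smul _ _ _
      map_smul' := fun a b => by simp [mul_smul] }
  have hf (l : L) (w : W) : f (l ⊗ₜ w) = l • i w := rfl
  have hTadd (v v' : V) : T (v + v') = T v + T v' := hi <| by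
    simp [hT, Finset.sum_add_distrib]
  -- The inverse of `f` comes from `eq_sum_smul_trace`, with the traces lifted to `W` by `T`.
  have hinj : Function.LeftInverse (fun v => ∑ k, e k ⊗ₜ T (d k • v)) f := by
    intro t
    induction t with
    | zero =>
      have : T 0 = 0 := hi (by simp [hT])
      simp [this]
    | add x y hx hy =>
      simp only at hx hy
      conv_rhs => rw [← hx, ← hy]
      simp [hTadd, TensorProduct.tmul_add, Finset.sum_add_distrib]
    | tmul l w =>
      have hTk (k : Fin n) : T (d k • l • i w) = Algebra.trace K L (d k * l) • w := hi <| by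
        rw [hT, map_smul, ← algebraMap_smul L (Algebra.trace K L _) (i w), trace_eq_sum_automorphisms, Finset.sum_smul]
        refine Finset.sum_congr rfl fun σ _ => ?_
        rw [smul_smul, hρ, (hr _).1 ⟨w, rfl⟩]
      simp only [hf, hTk, ← TensorProduct.smul_tmul]
      rw [← TensorProduct.sum_tmul]
      congr 1
      simp only [Algebra.smul_def, trace_eq_sum_automorphisms, Finset.sum_mul]
      rw [Finset.sum_comm]
      have (σ : Gal(L/K)) : ∑ k, σ (d k * l) * e k = if σ = 1 then σ l else 0 := by
        rw [← one_mul (σ l), ← zero_mul (σ l), ← ite_mul, ← hed, Finset.sum_mul]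
        refine Finset.sum_congr rfl fun k _ => ?_
        rw [map_mul]
        ring
      simp_rw [this]
      simp
  have hsurj : Function.Surjective f := fun v => by
    refine ⟨∑ k, e k ⊗ₜ T (d k • v), ?_⟩
    simp only [map_sum, hf, hT]
    exact (eq_sum_smul_trace ρ hρ hed v).symm
  have hbij : Function.Bijective f := ⟨hinj.injective, hsurj⟩
  exact IsBaseChange.of_equiv (LinearEquiv.ofBijective f hbij) fun w => by
    rw [LinearEquiv.ofBijective_apply, hf, one_smul]

end GaloisDescent

lemma LinearMap.exists_comp_eq_of_injective {R M M' M'' : Type*} [CommRing R] [AddCommGroup M]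
    [Module R M] [AddCommGroup M'] [Module R M'] [AddCommGroup M''] [Module R M'']
    (f : M' →ₗ[R] M'') (hf : Function.Injective f) (g : M →ₗ[R] M'')
    (h : ∀ m, g m ∈ LinearMap.range f) : ∃ k : M →ₗ[R] M', ∀ m, f (k m) = g m :=
  ⟨(LinearEquiv.ofInjective f hf).symm.toLinearMap ∘ₗ g.codRestrict (LinearMap.range f) h,
    fun m => congrArg Subtype.val
      ((LinearEquiv.ofInjective f hf).apply_symm_apply (g.codRestrict (LinearMap.range f) h m))⟩

/-- Pointwise preimages suffice: the maps into which they are lifted are injective, so the choices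
are unique and therefore linear. -/
lemma HopfDescentData.nonempty_of_forall_exists {K L H A : Type*} [Field K] [Field L] [Algebra K L]
    [Ring H] [Ring A] [Algebra K A] [Algebra K H] [HopfAlgebra L A] [IsScalarTower K L A]
    {i : H →ₐ[K] A} (hb : IsBaseChange L i.toLinearMap)
    (hΔ : ∀ h, ∃ t, tensorForm L i.toLinearMap i.toLinearMap t = Coalgebra.comul (R := L) (i h))
    (hε : ∀ h, ∃ k, algebraMap K L k = Coalgebra.counit (R := L) (i h))
    (hS : ∀ h, ∃ h', i h' = HopfAlgebra.antipode L (i h)) : Nonempty (HopfDescentData L i) := by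
  obtain ⟨δ, hδ⟩ := LinearMap.exists_comp_eq_of_injective _ (hb.tensorForm hb).injective
    ((Coalgebra.comul (R := L)).restrictScalars K ∘ₗ i.toLinearMap) hΔ
  obtain ⟨ε, hε⟩ := LinearMap.exists_comp_eq_of_injective (Algebra.linearMap K L)
    (algebraMap K L).injective
    ((Coalgebra.counit (R := L)).restrictScalars K ∘ₗ i.toLinearMap) hε
  obtain ⟨S, hS⟩ := LinearMap.exists_comp_eq_of_injective i.toLinearMap hb.injective
    ((HopfAlgebra.antipode L).restrictScalars K ∘ₗ i.toLinearMap) hS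
  exact ⟨⟨δ, ε, S, hb, hδ, hε, hS⟩⟩

/-! ### The Galois action on `L[N]` and its fixed algebra. -/

section Twist

variable {K L N : Type*} [Field K] [Field L] [Algebra K L] [Group N] (ψ : Gal(L/K) →* MulAut N)

/-- The semilinear action of the Galois group on `L[N]`, where `N` is a group on which the Galois
group acts. -/
noncomputable def galoisTwist : Gal(L/K) →* (MonoidAlgebra L N →ₐ[K] MonoidAlgebra L N) where
  toFun σ := (MonoidAlgebra.mapDomainAlgHom K L (ψ σ : N →* N)).comp
    (MonoidAlgebra.mapAlgHom N (σ : L →ₐ[K] L))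
  map_one' := by
    refine AlgHom.ext fun z => ?_
    induction z using MonoidAlgebra.induction_linear with
    | zero => simp
    | add x y hx hy => simp only [map_add, hx, hy]
    | single η l => simp
  map_mul' σ τ := by
    refine AlgHom.ext fun z => ?_
    induction z using MonoidAlgebra.induction_linear with
    | zero => simp
    | add x y hx hy => simp only [map_add, hx, hy]
    | single η l => simp

@[simp]
lemma galoisTwist_single (σ : Gal(L/K)) (η : N) (l : L) :
    galoisTwist ψ σ (MonoidAlgebra.single η l) = MonoidAlgebra.single (ψ σ η) (σ l) := by
  simp [galoisTwist]

lemma galoisTwist_smul (σ : Gal(L/K)) (l : L) (z : MonoidAlgebra L N) :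
    galoisTwist ψ σ (l • z) = σ l • galoisTwist ψ σ z := by
  induction z using MonoidAlgebra.induction_linear with
  | zero => simp
  | add x y hx hy => simp only [map_add, smul_add, hx, hy]
  | single η l => simp

lemma counit_galoisTwist (σ : Gal(L/K)) (z : MonoidAlgebra L N) :
    Coalgebra.counit (R := L) (galoisTwist ψ σ z) = σ (Coalgebra.counit (R := L) z) := by
  induction z using MonoidAlgebra.induction_linear with
  | zero => simp
  | add x y hx hy => simp only [map_add, hx, hy]
  | single η l => simp

lemma antipode_galoisTwist (σ : Gal(L/K)) (z : MonoidAlgebra L N) :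
    HopfAlgebra.antipode L (galoisTwist ψ σ z) = galoisTwist ψ σ (HopfAlgebra.antipode L z) := by
  induction z using MonoidAlgebra.induction_linear with
  | zero => simp
  | add x y hx hy => simp only [map_add, hx, hy]
  | single η l => simp

/-- The subalgebra of `L[N]` that is fixed by the Galois group. -/
noncomputable def twistedGroupAlgebra : Subalgebra K (MonoidAlgebra L N) where
  carrier := {z | ∀ σ, galoisTwist ψ σ z = z}
  mul_mem' hx hy σ := by rw [map_mul, hx, hy]
  add_mem' hx hy σ := by rw [map_add, hx, hy]
  algebraMap_mem' k σ := AlgHom.commutes _ _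

/-- The semilinear action of the Galois group on `L[N]`, as a representation. -/
noncomputable def galoisTwistRep : Gal(L/K) →* Module.End K (MonoidAlgebra L N) where
  toFun σ := (galoisTwist ψ σ).toLinearMap
  map_one' := by simp; rfl
  map_mul' σ τ := by simp; rfl

lemma sum_galoisTwist_mem [Fintype Gal(L/K)] (z : MonoidAlgebra L N) :
    ∑ σ, galoisTwist ψ σ z ∈ twistedGroupAlgebra ψ := fun τ => by
  rw [map_sum]
  refine Fintype.sum_equiv (Equiv.mulLeft τ) _ _ fun σ => ?_
  simp

lemma antipode_mem_twistedGroupAlgebra {z : MonoidAlgebra L N} (h : z ∈ twistedGroupAlgebra ψ) :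
    HopfAlgebra.antipode L z ∈ twistedGroupAlgebra ψ := fun σ => by
  rw [← antipode_galoisTwist, h σ]

variable [FiniteDimensional K L] [IsGalois K L]

lemma isBaseChange_twistedGroupAlgebra :
    IsBaseChange L (twistedGroupAlgebra ψ).val.toLinearMap :=
  isBaseChange_of_range_eq_invariants (galoisTwistRep ψ) (galoisTwist_smul ψ) _
    Subtype.val_injective fun v => ⟨by rintro ⟨w, rfl⟩; exact w.2, fun h => ⟨⟨v, h⟩, rfl⟩⟩

/-- Every fixed element is a trace, so traces of `l η` suffice. With `t i` the trace of `d i • η`,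
each conjugate `ψ σ η` is `∑ σ(e i) t i`; as it is group-like, summing over `σ` leaves the
coefficients `Tr(l * e i * e j)`, which lie in `K`. -/
lemma comul_mem_range_tensorForm (h : twistedGroupAlgebra ψ) :
    Coalgebra.comul (R := L) (h : MonoidAlgebra L N) ∈
      LinearMap.range (tensorForm L (twistedGroupAlgebra ψ).val.toLinearMap
        (twistedGroupAlgebra ψ).val.toLinearMap) := by
  obtain ⟨n, e, d, hed⟩ := exists_galois_coordinates K L
  have key (z : MonoidAlgebra L N) : Coalgebra.comul (R := L) (∑ σ, galoisTwist ψ σ z) ∈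
      LinearMap.range (tensorForm L (twistedGroupAlgebra ψ).val.toLinearMap
        (twistedGroupAlgebra ψ).val.toLinearMap) := by
    induction z using MonoidAlgebra.induction_linear with
    | zero => simp
    | add x y hx hy =>
      simp only [map_add, Finset.sum_add_distrib]
      exact add_mem hx hy
    | single η l =>
      let t (i : Fin n) : twistedGroupAlgebra ψ :=
        ⟨∑ σ, galoisTwist ψ σ (d i • MonoidAlgebra.single η (1 : L)), sum_galoisTwist_mem ψ _⟩
      have ht (σ : Gal(L/K)) : MonoidAlgebra.single (ψ σ η) (1 : L) =
          ∑ i, σ (e i) • (t i : MonoidAlgebra L N) := by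
        have := congrArg (galoisTwist ψ σ) (eq_sum_smul_trace (galoisTwistRep ψ)
          (galoisTwist_smul ψ) hed (MonoidAlgebra.single η (1 : L)))
        rw [galoisTwist_single, map_one, map_sum] at this
        rw [this]
        refine Finset.sum_congr rfl fun i _ => ?_
        rw [galoisTwist_smul]
        exact congrArg _ ((t i).2 σ)
      refine ⟨∑ i, ∑ j, Algebra.trace K L (l * e i * e j) • (t i ⊗ₜ t j), ?_⟩
      simp only [map_sum, map_smul, galoisTwist_single]
      have (σ : Gal(L/K)) : Coalgebra.comul (R := L) (MonoidAlgebra.single (ψ σ η) (σ l)) =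
          ∑ i, ∑ j, σ (l * e i * e j) •
            ((t i : MonoidAlgebra L N) ⊗ₜ[L] (t j : MonoidAlgebra L N)) := by
        have h1 : MonoidAlgebra.single (ψ σ η) (σ l) =
          σ l • MonoidAlgebra.single (ψ σ η) (1 : L) := by simp
        rw [h1, map_smul, MonoidAlgebra.comul_single, CommSemiring.comul_apply,
          TensorProduct.map_tmul, MonoidAlgebra.lsingle_apply, ht, TensorProduct.sum_tmul,
          Finset.smul_sum]
        refine Finset.sum_congr rfl fun i _ => ?_
        rw [TensorProduct.tmul_sum, Finset.smul_sum]
        refine Finset.sum_congr rfl fun j _ => ?_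
        rw [TensorProduct.smul_tmul_smul, smul_smul, map_mul, map_mul, mul_assoc]
      simp only [this]
      symm
      rw [Finset.sum_comm]
      refine Finset.sum_congr rfl fun i _ => ?_
      rw [Finset.sum_comm]
      refine Finset.sum_congr rfl fun j _ => ?_
      rw [← Finset.sum_smul, ← trace_eq_sum_automorphisms, algebraMap_smul]
      rfl
  -- An element `c` of trace `1` exhibits the fixed element `h` as the trace of `c • h`.
  obtain ⟨c, hc⟩ := Algebra.trace_surjective K L 1
  have : (h : MonoidAlgebra L N) = ∑ σ, galoisTwist ψ σ (c • (h : MonoidAlgebra L N)) := by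
    have hh (σ) : galoisTwist ψ σ h = h := h.2 σ
    simp only [galoisTwist_smul, hh]
    rw [← Finset.sum_smul, ← trace_eq_sum_automorphisms, hc, map_one, one_smul]
  rw [this]
  exact key _

lemma counit_mem_range_algebraMap (h : twistedGroupAlgebra ψ) :
    Coalgebra.counit (R := L) (h : MonoidAlgebra L N) ∈
      LinearMap.range (Algebra.linearMap K L) := by
  have := (IsGalois.mem_bot_iff_fixed (F := K)
    (Coalgebra.counit (R := L) (h : MonoidAlgebra L N))).2 fun σ => by
      rw [← counit_galoisTwist ψ, h.2 σ]
  obtain ⟨k, hk⟩ := IntermediateField.mem_bot.1 this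
  exact ⟨k, hk⟩

/-- Galois descent for the Hopf algebra `L[N]`. -/
lemma nonempty_hopfDescentData : Nonempty (HopfDescentData L (twistedGroupAlgebra ψ).val) :=
  HopfDescentData.nonempty_of_forall_exists (isBaseChange_twistedGroupAlgebra ψ)
    (comul_mem_range_tensorForm ψ) (counit_mem_range_algebraMap ψ)
    fun h => ⟨⟨_, antipode_mem_twistedGroupAlgebra ψ h.2⟩, rfl⟩

end Twist

/-! ### The action of `L[N]` on functions and its evaluation at `1`. -/

section PermAction

variable {K L : Type*} [Field K] [Field L] [Algebra K L]

section

variable {Γ : Type*} (N : Subgroup (Equiv.Perm Γ))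

lemma permAction_single_apply (η : N) (l : L) (f : Γ → L) (γ : Γ) :
    permAction L N (MonoidAlgebra.single η l) f γ = l * f ((η : Equiv.Perm Γ)⁻¹ γ) := by
  simp [permAction, MonoidAlgebra.lift_single, LinearMap.funLeft]

end

@[simp]
lemma galoisSplitting_tmul_apply (x y : L) (γ : Gal(L/K)) :
    galoisSplitting K L (x ⊗ₜ y) γ = x * γ y := by
  simp [galoisSplitting, Algebra.ofId_apply]

/-- The semilinear action of the Galois group on functions on the Galois group. -/
def galoisFunTwist (σ : Gal(L/K)) (f : Gal(L/K) → L) : Gal(L/K) → L :=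
  fun γ => σ (f (σ⁻¹ * γ))

lemma galoisFunTwist_galoisSplitting (σ : Gal(L/K)) (y : L) :
    galoisFunTwist σ (galoisSplitting K L (1 ⊗ₜ y)) = galoisSplitting K L (1 ⊗ₜ y) := by
  ext γ
  simp only [galoisFunTwist, galoisSplitting_tmul_apply, one_mul]
  rw [← AlgEquiv.mul_apply, mul_inv_cancel_left]

variable {N : Subgroup (Equiv.Perm Gal(L/K))} {ψ : Gal(L/K) →* MulAut N}

/-- The hypothesis `hψ` says that `ψ σ` is conjugation by left translation by `σ`, which makes the
action of `L[N]` equivariant. -/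
lemma permAction_galoisTwist (hψ : ∀ σ (η : N) γ, (ψ σ η : Equiv.Perm _) (σ * γ) =
      σ * (η : Equiv.Perm _) γ)
    (σ : Gal(L/K)) (z : MonoidAlgebra L N) (f : Gal(L/K) → L) :
    permAction L N (galoisTwist ψ σ z) (galoisFunTwist σ f) =
      galoisFunTwist σ (permAction L N z f) := by
  induction z using MonoidAlgebra.induction_linear with
  | zero => ext; simp [galoisFunTwist]
  | add x y hx hy =>
    simp only [map_add, LinearMap.add_apply, hx, hy]
    ext
    simp [galoisFunTwist]
  | single η l =>
    ext γ
    rw [galoisTwist_single, permAction_single_apply]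
    simp only [galoisFunTwist, permAction_single_apply, map_mul]
    congr 3
    rw [inv_mul_eq_iff_eq_mul, Equiv.Perm.inv_eq_iff_eq, hψ]
    simp

/-- The endomorphism `∑ l_η η⁻¹(1)` of `L` that belongs to `∑ l_η η ∈ L[N]`. -/
noncomputable def groupAlgebraEval (N : Subgroup (Equiv.Perm Gal(L/K))) (y : L) :
    MonoidAlgebra L N →ₗ[L] L :=
  LinearMap.proj 1 ∘ₗ (permAction L N).toLinearMap.flip (galoisSplitting K L (1 ⊗ₜ y))

lemma groupAlgebraEval_apply (z : MonoidAlgebra L N) (y : L) :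
    groupAlgebraEval N y z = permAction L N z (galoisSplitting K L (1 ⊗ₜ y)) 1 := rfl

lemma groupAlgebraEval_single (η : N) (l y : L) :
    groupAlgebraEval N y (MonoidAlgebra.single η l) = l * ((η : Equiv.Perm Gal(L/K))⁻¹ 1) y := by
  simp [groupAlgebraEval_apply, permAction_single_apply]

/-- Each `η` is group-like and acts through the field automorphism `η⁻¹(1)`. -/
lemma groupAlgebraEval_mul (x y : L) (z : MonoidAlgebra L N) :
    groupAlgebraEval N (x * y) z = LinearMap.mul' L L
      (TensorProduct.map (groupAlgebraEval N x) (groupAlgebraEval N y)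
        (Coalgebra.comul (R := L) z)) := by
  induction z using MonoidAlgebra.induction_linear with
  | zero => simp
  | add x y hx hy => simp only [map_add, hx, hy]
  | single η l =>
    simp only [groupAlgebraEval_single, MonoidAlgebra.comul_single, CommSemiring.comul_apply,
      TensorProduct.map_tmul, MonoidAlgebra.lsingle_apply, LinearMap.mul'_apply, map_mul]
    ring

lemma groupAlgebraEval_one (z : MonoidAlgebra L N) :
    groupAlgebraEval N 1 z = Coalgebra.counit (R := L) z := by
  induction z using MonoidAlgebra.induction_linear with
  | zero => simp
  | add x y hx hy => simp only [map_add, hx, hy]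
  | single η l => simp [groupAlgebraEval_single]

lemma groupAlgebraEval_add (x y : L) (z : MonoidAlgebra L N) :
    groupAlgebraEval N (x + y) z = groupAlgebraEval N x z + groupAlgebraEval N y z := by
  simp [groupAlgebraEval_apply, TensorProduct.tmul_add]

lemma groupAlgebraEval_smul (k : K) (y : L) (z : MonoidAlgebra L N) :
    groupAlgebraEval N (k • y) z = k • groupAlgebraEval N y z := by
  induction z using MonoidAlgebra.induction_linear with
  | zero => simp
  | add x y hx hy => simp only [map_add, hx, hy, smul_add]
  | single η l => simp [groupAlgebraEval_single]

/-- The left side is fixed by the twist, and a fixed function satisfies `f(γ) = γ(f(1))`. Hence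
fixed elements of `L[N]` preserve the copy of `L` in `Map(Γ, L)`. -/
lemma permAction_eq_galoisSplitting (hψ : ∀ σ (η : N) γ, (ψ σ η : Equiv.Perm _) (σ * γ) =
      σ * (η : Equiv.Perm _) γ) {z : MonoidAlgebra L N} (hz : z ∈ twistedGroupAlgebra ψ) (y : L) :
    permAction L N z (galoisSplitting K L (1 ⊗ₜ y)) =
      galoisSplitting K L (1 ⊗ₜ groupAlgebraEval N y z) := by
  ext γ
  have h := congrFun (permAction_galoisTwist hψ γ z (galoisSplitting K L (1 ⊗ₜ y))) γ
  rw [hz γ, galoisFunTwist_galoisSplitting] at h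
  rw [h, galoisFunTwist, inv_mul_cancel, galoisSplitting_tmul_apply, one_mul]
  rfl

/-- Dedekind independence of the distinct automorphisms `η⁻¹(1)`. -/
lemma groupAlgebraEval_injective (hN : Function.Injective fun η : N => (η : Equiv.Perm Gal(L/K))⁻¹ 1)
    {z : MonoidAlgebra L N} (hz : ∀ y, groupAlgebraEval (K := K) N y z = 0) : z = 0 := by
  have hinj : Function.Injective (fun η : N =>
      (((η : Equiv.Perm Gal(L/K))⁻¹ 1 : Gal(L/K)) : L →* L)) := fun η θ h =>
    hN (AlgEquiv.ext fun x => DFunLike.congr_fun h x)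
  have hli := (linearIndependent_monoidHom L L).comp _ hinj
  apply MonoidAlgebra.coeff_injective
  rw [linearIndependent_iff] at hli
  apply hli
  ext y
  rw [Finsupp.linearCombination_apply, Finsupp.sum, Finset.sum_apply]
  refine Eq.trans ?_ (hz y)
  conv_rhs => rw [← MonoidAlgebra.sum_coeff_single z, Finsupp.sum, map_sum]
  refine Finset.sum_congr rfl fun η _ => ?_
  rw [groupAlgebraEval_single]
  rfl

lemma exists_groupAlgebraEval_eq [FiniteDimensional K L] [IsGalois K L]
    (hN : Function.Surjective fun η : N => (η : Equiv.Perm Gal(L/K))⁻¹ 1) (φ : Module.End K L) :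
    ∃ z : MonoidAlgebra L N, ∀ y, groupAlgebraEval N y z = φ y := by
  classical
  obtain ⟨n, e, d, hed⟩ := exists_galois_coordinates K L
  choose s hs using hN
  -- Applying `φ` to `y = ∑ Tr(d i * y) • e i` and expanding the trace gives `φ(y) = ∑ γ, (∑ i, φ(e
  -- i) * γ(d i)) * γ(y)`.
  refine ⟨∑ γ, MonoidAlgebra.single (s γ) (∑ i, φ (e i) * γ (d i)), fun y => ?_⟩
  have hy : y = ∑ i, Algebra.trace K L (d i * y) • e i := by
    simp only [Algebra.smul_def, trace_eq_sum_automorphisms, Finset.sum_mul]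
    rw [Finset.sum_comm]
    have (σ : Gal(L/K)) : ∑ k, σ (d k * y) * e k = if σ = 1 then σ y else 0 := by
      rw [← one_mul (σ y), ← zero_mul (σ y), ← ite_mul, ← hed, Finset.sum_mul]
      refine Finset.sum_congr rfl fun k _ => ?_
      rw [map_mul]
      ring
    simp_rw [this]
    simp
  conv_rhs => rw [hy]
  simp only [map_sum, map_smul, groupAlgebraEval_single]
  simp only [Algebra.smul_def, trace_eq_sum_automorphisms, Finset.sum_mul]
  rw [Finset.sum_comm]
  refine Finset.sum_congr rfl fun i _ => Finset.sum_congr rfl fun γ _ => ?_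
  have : (s γ : Equiv.Perm Gal(L/K))⁻¹ 1 = γ := hs γ
  rw [this, map_mul]
  ring

end PermAction

/-! ### The Hopf Galois structure of a fixed form. -/

namespace IsHopfForm

variable {K L H : Type*} [Field K] [Field L] [Algebra K L] [Ring H] [HopfAlgebra K H]
  {N : Subgroup (Equiv.Perm Gal(L/K))} {ψ : Gal(L/K) →* MulAut N} {i : H →ₐ[K] MonoidAlgebra L N}

/-- The action on `L` of a form of `L[N]` that is fixed by the Galois group. -/
noncomputable def action (hψ : ∀ σ (η : N) γ, (ψ σ η : Equiv.Perm _) (σ * γ) =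
      σ * (η : Equiv.Perm _) γ) (hr : ∀ h, i h ∈ twistedGroupAlgebra ψ) :
    H →ₐ[K] Module.End K L :=
  AlgHom.ofLinearMap
    { toFun := fun h =>
        { toFun := fun y => groupAlgebraEval N y (i h)
          map_add' := fun x y => groupAlgebraEval_add x y _
          map_smul' := fun k y => groupAlgebraEval_smul k y _ }
      map_add' := fun g h => by ext; simp
      map_smul' := fun k h => by
        ext y
        simp only [map_smul, LinearMap.coe_mk, AddHom.coe_mk, RingHom.id_apply,
          LinearMap.smul_apply]
        rw [← algebraMap_smul L k (i h), map_smul, algebraMap_smul] }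
    (by
      ext y
      simp [groupAlgebraEval_apply])
    (by
      intro g h
      ext y
      simp only [map_mul, LinearMap.coe_mk, AddHom.coe_mk, Module.End.mul_apply]
      -- Evaluation at `1` respects products here because `i h` is fixed, so it sends `γ ↦ γ(y)` to
      -- a function of the same shape.
      rw [groupAlgebraEval_apply, map_mul, Module.End.mul_apply,
        permAction_eq_galoisSplitting hψ (hr h), ← groupAlgebraEval_apply])

lemma action_apply (hψ : ∀ σ (η : N) γ, (ψ σ η : Equiv.Perm _) (σ * γ) =
      σ * (η : Equiv.Perm _) γ) (hr : ∀ h, i h ∈ twistedGroupAlgebra ψ) (h : H) (y : L) :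
    action hψ hr h y = groupAlgebraEval N y (i h) := rfl

variable [FiniteDimensional K L] [IsGalois K L]

/-- The Hopf Galois structure given by a form of `L[N]` that is fixed by the Galois group. -/
noncomputable def hopfGaloisStructure (hi : IsHopfForm L i)
    (hψ : ∀ σ (η : N) γ, (ψ σ η : Equiv.Perm _) (σ * γ) = σ * (η : Equiv.Perm _) γ)
    (hr : ∀ h, i h ∈ twistedGroupAlgebra ψ)
    (hN : Function.Bijective fun η : N => (η : Equiv.Perm Gal(L/K))⁻¹ 1) :
    HopfGaloisStructure K L H where
  action := action hψ hr
  action_one h := by rw [action_apply, groupAlgebraEval_one, hi.counit_spec]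
  action_mul h x y := by
    rw [action_apply, groupAlgebraEval_mul, ← hi.comul_spec]
    generalize Coalgebra.comul (R := K) h = t
    induction t with
    | zero => simp
    | add x y hx hy => simp only [map_add, hx, hy]
    | tmul v w => simp [action_apply]
  bijective := by
    -- The map `j` is the isomorphism `L ⊗ H ≅ L[N]` followed by evaluation, whose bijectivity comes
    -- from `hN`.
    have hfac (t : L ⊗[K] H) (y : L) :
        TensorProduct.lift ((LinearMap.mul K (Module.End K L)).compl₁₂
          (Algebra.lmul K L).toLinearMap (action hψ hr).toLinearMap) t y =
        groupAlgebraEval N y (i.baseChangeLift t) := by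
      induction t with
      | zero => simp
      | add s t hs ht => simp only [map_add, LinearMap.add_apply, hs, ht]
      | tmul l h => simp [action_apply]
    have hb := hi.isBaseChange.bijective_baseChangeLift
    refine ⟨(injective_iff_map_eq_zero _).2 fun t ht => ?_, fun φ => ?_⟩
    · refine (injective_iff_map_eq_zero _).1 hb.1 t
        (groupAlgebraEval_injective (K := K) hN.1 fun y => ?_)
      rw [← hfac, ht, LinearMap.zero_apply]
    · obtain ⟨z, hz⟩ := exists_groupAlgebraEval_eq hN.2 φ
      obtain ⟨t, rfl⟩ := hb.2 z
      exact ⟨t, LinearMap.ext fun y => (hfac t y).trans (hz y)⟩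

/-- The Hopf Galois structure of a form of `L[N]` corresponds to `N`. -/
noncomputable def correspondence (hi : IsHopfForm L i)
    (hψ : ∀ σ (η : N) γ, (ψ σ η : Equiv.Perm _) (σ * γ) = σ * (η : Equiv.Perm _) γ)
    (hr : ∀ h, i h ∈ twistedGroupAlgebra ψ)
    (hN : Function.Bijective fun η : N => (η : Equiv.Perm Gal(L/K))⁻¹ 1) :
    (hi.hopfGaloisStructure hψ hr hN).Correspondence N where
  iso := hi.baseChangeEquiv
  compatible z t := by
    induction z with
    | zero => simp
    | add y z hy hz => simp only [map_add, LinearMap.add_apply, hy, hz]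
    | tmul l h =>
      induction t with
      | zero => simp
      | add y z hy hz => simp only [map_add, hy, hz]
      | tmul x y =>
        have hsmul (a b : L) : galoisSplitting K L (a ⊗ₜ b) = a • galoisSplitting K L (1 ⊗ₜ b) := by
          ext γ
          simp
        rw [baseChangeEquiv_tmul, map_smul, hsmul x y, LinearMap.smul_apply, map_smul,
          permAction_eq_galoisSplitting hψ (hr h), smul_smul, ← hsmul]
        rfl

end IsHopfForm

/-! ### Uniqueness: the image of `H` in `L[N]`. -/

namespace HopfGaloisStructure

variable {K L H : Type*} [Field K] [Field L] [Algebra K L] [Ring H] [HopfAlgebra K H]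
  {S : HopfGaloisStructure K L H} {N : Subgroup (Equiv.Perm Gal(L/K))}
  {ψ : Gal(L/K) →* MulAut N}

namespace Correspondence

variable (C : S.Correspondence N)

/-- The embedding of `H` into `L[N]` given by the isomorphism `L ⊗ H ≅ L[N]`. -/
noncomputable def embedding : H →ₐ[K] MonoidAlgebra L N :=
  ((C.iso : L ⊗[K] H →ₐ[L] MonoidAlgebra L N).restrictScalars K).comp
    Algebra.TensorProduct.includeRight

lemma embedding_apply (h : H) : C.embedding h = C.iso (1 ⊗ₜ h) := rfl

lemma isHopfForm_embedding : IsHopfForm L C.embedding := IsHopfForm.of_equiv C.iso C.embedding_apply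

lemma permAction_embedding (h : H) (y : L) :
    permAction L N (C.embedding h) (galoisSplitting K L (1 ⊗ₜ y)) =
      galoisSplitting K L (1 ⊗ₜ S.action h y) := by
  rw [embedding_apply, ← C.compatible]
  change galoisSplitting K L (((1 : L) • (S.action h).baseChange L) (1 ⊗ₜ y)) = _
  simp

lemma groupAlgebraEval_embedding (h : H) (y : L) :
    groupAlgebraEval N y (C.embedding h) = S.action h y := by
  rw [groupAlgebraEval_apply, permAction_embedding, galoisSplitting_tmul_apply]
  simp

variable (hψ : ∀ σ (η : N) γ, (ψ σ η : Equiv.Perm _) (σ * γ) = σ * (η : Equiv.Perm _) γ)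
  (hN : Function.Injective fun η : N => (η : Equiv.Perm Gal(L/K))⁻¹ 1)

include hψ hN

/-- By equivariance, the twist of the image of `h` by `σ` has the same evaluations as the image
itself, and evaluation is injective. -/
lemma embedding_mem (h : H) : C.embedding h ∈ twistedGroupAlgebra ψ := fun σ => by
  rw [← sub_eq_zero]
  refine groupAlgebraEval_injective (K := K) hN fun y => ?_
  rw [map_sub, groupAlgebraEval_apply, ← galoisFunTwist_galoisSplitting σ,
    permAction_galoisTwist hψ, permAction_embedding, galoisFunTwist_galoisSplitting,
    groupAlgebraEval_embedding, galoisSplitting_tmul_apply]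
  simp

/-- Both `H` and the fixed algebra become `L[N]` over `L`, so the inclusion is surjective after base
change, hence surjective by faithful flatness. -/
lemma range_embedding [FiniteDimensional K L] [IsGalois K L] :
    C.embedding.range = twistedGroupAlgebra ψ := by
  refine le_antisymm (by rintro _ ⟨h, rfl⟩; exact C.embedding_mem hψ hN h) fun z hz => ?_
  let k : H →ₗ[K] twistedGroupAlgebra ψ :=
    (C.embedding.codRestrict _ (C.embedding_mem hψ hN)).toLinearMap
  have hb := isBaseChange_twistedGroupAlgebra ψ
  have hk : Function.Surjective k := by
    rw [← Module.FaithfullyFlat.lTensor_surjective_iff_surjective K L]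
    intro t
    obtain ⟨s, hs⟩ := C.isHopfForm_embedding.isBaseChange.equiv.surjective (hb.equiv t)
    refine ⟨s, hb.equiv.injective (Eq.trans ?_ hs)⟩
    clear hs
    induction s with
    | zero => simp
    | add x y hx hy => simp only [map_add, hx, hy]
    | tmul l h =>
      rw [LinearMap.lTensor_tmul, IsBaseChange.equiv_tmul, IsBaseChange.equiv_tmul]
      rfl
  obtain ⟨h, hh⟩ := hk ⟨z, hz⟩
  exact ⟨h, congrArg Subtype.val hh⟩

end Correspondence

end HopfGaloisStructure

/-- Two forms of an `L`-Hopf algebra with the same range are isomorphic. -/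
lemma IsHopfForm.exists_equiv {K L H₁ H₂ A : Type*} [Field K] [Field L] [Algebra K L] [Ring A]
    [Algebra K A] [HopfAlgebra L A] [IsScalarTower K L A] [Ring H₁] [HopfAlgebra K H₁] [Ring H₂]
    [HopfAlgebra K H₂] {i₁ : H₁ →ₐ[K] A} {i₂ : H₂ →ₐ[K] A} (h₁ : IsHopfForm L i₁)
    (h₂ : IsHopfForm L i₂) (h : i₁.range = i₂.range) :
    ∃ e : H₁ ≃ₐc[K] H₂, ∀ x, i₂ (e x) = i₁ x := by
  let e : H₁ ≃ₐ[K] H₂ := (AlgEquiv.ofInjective i₁ h₁.isBaseChange.injective).trans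
    ((Subalgebra.equivOfEq _ _ h).trans (AlgEquiv.ofInjective i₂ h₂.isBaseChange.injective).symm)
  have he (x : H₁) : i₂ (e x) = i₁ x :=
    congrArg Subtype.val ((AlgEquiv.ofInjective i₂ h₂.isBaseChange.injective).apply_symm_apply
      (Subalgebra.equivOfEq _ _ h (AlgEquiv.ofInjective i₁ h₁.isBaseChange.injective x)))
  refine ⟨BialgEquiv.ofAlgEquiv e ?_ ?_, he⟩
  · ext x
    apply (algebraMap K L).injective
    refine (h₂.counit_spec (e x)).trans ?_
    rw [he]
    exact (h₁.counit_spec x).symm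
  · ext x
    apply (h₂.isBaseChange.tensorForm h₂.isBaseChange).injective
    refine Eq.trans ?_ (h₂.comul_spec (e x)).symm
    rw [he, ← h₁.comul_spec]
    refine (tensorForm_map (f := e.toLinearMap) (g := e.toLinearMap) (F := LinearMap.id)
      (G := LinearMap.id) (i := i₁.toLinearMap) (j := i₁.toLinearMap) he he _).trans ?_
    simp

/-- A form of a cocommutative Hopf algebra is cocommutative. -/
lemma IsHopfForm.isCocomm {K L H A : Type*} [Field K] [Field L] [Algebra K L] [Ring A]
    [Algebra K A] [HopfAlgebra L A] [IsScalarTower K L A] [Ring H] [HopfAlgebra K H]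
    {i : H →ₐ[K] A} (hi : IsHopfForm L i) [Coalgebra.IsCocomm L A] : Coalgebra.IsCocomm K H where
  comm_comp_comul := by
    ext h
    apply (hi.isBaseChange.tensorForm hi.isBaseChange).injective
    simp only [LinearMap.comp_apply, LinearEquiv.coe_coe]
    rw [tensorForm_comm, hi.comul_spec, Coalgebra.comm_comul]

/-! ### Sub-Hopf algebras of a form and their `L`-spans. -/

section SubHopfAlgebra

variable {K L H A : Type*} [Field K] [Field L] [Ring H] [HopfAlgebra K H] [Ring A] [Algebra K A]
  [HopfAlgebra L A]

/-- A `K`-linear projection onto a subspace of a form extends to an `L`-linear projection. -/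
lemma IsBaseChange.exists_projection [Algebra K L] {V B : Type*} [AddCommGroup V] [Module K V] [AddCommGroup B]
    [Module K B] [Module L B] [IsScalarTower K L B] {i : V →ₗ[K] B} (hi : IsBaseChange L i)
    (J : Submodule K V) : ∃ (p : V →ₗ[K] J) (P : B →ₗ[L] B), (∀ x : J, p x = x) ∧
      (∀ x, P (i x) = i (p x)) ∧ ∀ b ∈ Submodule.span L (i '' J), P b = b := by
  obtain ⟨p, hp⟩ := J.subtype.exists_leftInverse_of_injective J.ker_subtype
  have hp (x : J) : p x = x := LinearMap.congr_fun hp x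
  refine ⟨p, hi.lift (i ∘ₗ J.subtype ∘ₗ p), hp, fun x => hi.lift_eq _ x, fun b hb => ?_⟩
  induction hb using Submodule.span_induction with
  | mem x hx =>
    obtain ⟨y, hy, rfl⟩ := hx
    rw [hi.lift_eq]
    simp [hp ⟨y, hy⟩]
  | zero => simp
  | add x y _ _ hx hy => rw [map_add, hx, hy]
  | smul l x _ hx => rw [map_smul, hx]

/-- A subspace of a form of `B` is the intersection of the form with its `L`-span. -/
lemma IsBaseChange.mem_of_mem_span [Algebra K L] {V B : Type*} [AddCommGroup V] [Module K V] [AddCommGroup B]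
    [Module K B] [Module L B] [IsScalarTower K L B] {i : V →ₗ[K] B} (hi : IsBaseChange L i)
    {J : Submodule K V} {x : V} (hx : i x ∈ Submodule.span L (i '' J)) : x ∈ J := by
  obtain ⟨p, P, -, hpP, hP⟩ := hi.exists_projection J
  have := (hpP x).symm.trans (hP _ hx)
  rw [← hi.injective this]
  exact (p x).2

namespace SubHopfAlgebra

variable {i : H →ₐ[K] A} (J : SubHopfAlgebra K H)

variable (L i) in
/-- The `L`-span in `A` of the image of a sub-Hopf algebra. -/
def spanImage : Submodule L A := Submodule.span L (i '' J.carrier)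

lemma mem_spanImage {x : H} (hx : x ∈ J.carrier) : i x ∈ J.spanImage L i :=
  Submodule.subset_span ⟨x, hx, rfl⟩

lemma one_mem_spanImage : (1 : A) ∈ J.spanImage L i := by
  rw [← map_one i]
  exact J.mem_spanImage (one_mem J.toSubalgebra)

lemma mul_mem_spanImage {a b : A} (ha : a ∈ J.spanImage L i) (hb : b ∈ J.spanImage L i) :
    a * b ∈ J.spanImage L i := by
  have h := Submodule.mul_mem_mul ha hb
  rw [spanImage, Submodule.span_mul_span] at h
  refine Submodule.span_mono ?_ h
  rintro _ ⟨_, ⟨x, hx, rfl⟩, _, ⟨y, hy, rfl⟩, rfl⟩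
  exact ⟨x * y, J.mul_mem' hx hy, map_mul i x y⟩

variable [Algebra K L] [IsScalarTower K L A]

lemma antipode_mem_spanImage (hi : IsHopfForm L i) {a : A} (ha : a ∈ J.spanImage L i) :
    HopfAlgebra.antipode L a ∈ J.spanImage L i := by
  induction ha using Submodule.span_induction with
  | mem x hx =>
    obtain ⟨y, hy, rfl⟩ := hx
    rw [← hi.map_antipode]
    exact J.mem_spanImage (J.antipode_mem y hy)
  | zero => simp
  | add x y _ _ hx hy => rw [map_add]; exact add_mem hx hy
  | smul l x _ hx => rw [map_smul]; exact Submodule.smul_mem _ l hx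

lemma comul_mem_spanImage (hi : IsHopfForm L i) {a : A} (ha : a ∈ J.spanImage L i) :
    Coalgebra.comul (R := L) a ∈ LinearMap.range
      (TensorProduct.map (J.spanImage L i).subtype (J.spanImage L i).subtype) := by
  induction ha using Submodule.span_induction with
  | mem x hx =>
    obtain ⟨y, hy, rfl⟩ := hx
    rw [← hi.comul_spec]
    obtain ⟨t, ht⟩ := J.comul_mem y hy
    rw [← ht]
    clear ht
    induction t with
    | zero => simp
    | add s t hs ht => simp only [map_add]; exact add_mem hs ht
    | tmul u v => exact ⟨⟨_, J.mem_spanImage u.2⟩ ⊗ₜ ⟨_, J.mem_spanImage v.2⟩, rfl⟩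
  | zero => simp
  | add x y _ _ hx hy => rw [map_add]; exact add_mem hx hy
  | smul l x _ hx => rw [map_smul]; exact Submodule.smul_mem _ l hx

/-- A subspace of `A` that is a sub-Hopf algebra and the span of its intersection with the form `H`
of `A` restricts to a sub-Hopf algebra of `H`. -/
noncomputable def ofSubmodule (hi : IsHopfForm L i) (B : Submodule L A) (h1 : (1 : A) ∈ B)
    (hmul : ∀ a ∈ B, ∀ b ∈ B, a * b ∈ B) (hS : ∀ a ∈ B, HopfAlgebra.antipode L a ∈ B)
    (hΔ : ∀ a ∈ B, Coalgebra.comul (R := L) a ∈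
      LinearMap.range (TensorProduct.map B.subtype B.subtype))
    (hB : B ≤ Submodule.span L (i '' (i ⁻¹' B))) : SubHopfAlgebra K H where
  carrier := i ⁻¹' B
  mul_mem' hx hy := by
    rw [Set.mem_preimage, map_mul]
    exact hmul _ hx _ hy
  add_mem' hx hy := by
    rw [Set.mem_preimage, map_add]
    exact add_mem hx hy
  algebraMap_mem' k := by
    rw [Set.mem_preimage, AlgHom.commutes, IsScalarTower.algebraMap_apply K L A,
      Algebra.algebraMap_eq_smul_one]
    exact B.smul_mem _ h1
  antipode_mem x hx := by
    rw [Set.mem_preimage, hi.map_antipode]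
    exact hS _ hx
  comul_mem x hx := by
    let J : Submodule K H := (B.restrictScalars K).comap i.toLinearMap
    obtain ⟨p, P, -, hpP, hP⟩ := hi.isBaseChange.exists_projection J
    have hPB (b : A) (hb : b ∈ B) : P b = b := hP b (hB hb)
    -- Since `P` is the identity on `B`, `P ⊗ P` fixes the comultiplication of `i x`; by injectivity
    -- `p ⊗ p` fixes that of `x`, which therefore lies in `J ⊗ J`.
    have key : TensorProduct.map (J.subtype ∘ₗ p) (J.subtype ∘ₗ p) (Coalgebra.comul x) =
        Coalgebra.comul (R := K) x := by
      apply (hi.isBaseChange.tensorForm hi.isBaseChange).injective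
      rw [tensorForm_map (F := P) (G := P) (i := i.toLinearMap) (j := i.toLinearMap)
        (fun v => (hpP v).symm) (fun v => (hpP v).symm), hi.comul_spec]
      obtain ⟨t, ht⟩ := hΔ _ hx
      rw [← ht, ← LinearMap.comp_apply, ← TensorProduct.map_comp]
      congr 2 <;> exact LinearMap.ext fun b => hPB _ b.2
    rw [← key, TensorProduct.map_comp]
    exact ⟨TensorProduct.map p p (Coalgebra.comul x), rfl⟩

end SubHopfAlgebra

end SubHopfAlgebra

/-! ### Sub-Hopf algebras and stable subgroups of `N`. -/

namespace SubHopfAlgebra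

variable {K L H N : Type*} [Field K] [Field L] [Algebra K L] [Ring H] [HopfAlgebra K H] [Group N]
  {i : H →ₐ[K] MonoidAlgebra L N}

lemma single_coeff_eq (z : MonoidAlgebra L N) (η : N) :
    TensorProduct.lid L _ (TensorProduct.map
      (Finsupp.lapply η ∘ₗ (MonoidAlgebra.coeffLinearEquiv L).toLinearMap) LinearMap.id
        (Coalgebra.comul (R := L) z)) = MonoidAlgebra.single η (z.coeff η) := by
  classical
  induction z using MonoidAlgebra.induction_linear with
  | zero => simp
  | add x y hx hy => simp only [map_add, hx, hy, MonoidAlgebra.coeff_add, Finsupp.add_apply,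
      MonoidAlgebra.single_add]
  | single θ l =>
    by_cases h : θ = η
    · subst h; simp
    · simp [h]

/-- A subcoalgebra of a group algebra is spanned by group elements. -/
lemma single_coeff_mem (hi : IsHopfForm L i) (J : SubHopfAlgebra K H) {z : MonoidAlgebra L N}
    (hz : z ∈ J.spanImage L i) (η : N) :
    MonoidAlgebra.single η (z.coeff η) ∈ J.spanImage L i := by
  obtain ⟨t, ht⟩ := J.comul_mem_spanImage hi hz
  -- A functional applied to the first factor of a tensor in `B ⊗ B`, where `B` is the span, leaves
  -- an element of `B`.
  rw [← single_coeff_eq, ← ht]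
  clear ht
  induction t with
  | zero => simp
  | add s t hs ht => simp only [map_add]; exact add_mem hs ht
  | tmul u v => simpa using Submodule.smul_mem _ _ v.2

/-- The group of the elements of `N` in the `L`-span of a sub-Hopf algebra of a form of `L[N]`. -/
def groupElements (hi : IsHopfForm L i) (J : SubHopfAlgebra K H) : Subgroup N where
  carrier := {η | MonoidAlgebra.single η (1 : L) ∈ J.spanImage L i}
  one_mem' := J.one_mem_spanImage
  mul_mem' {η θ} hη hθ := by
    have := J.mul_mem_spanImage hη hθ
    rwa [MonoidAlgebra.single_mul_single, one_mul] at this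
  inv_mem' {η} hη := by
    have := J.antipode_mem_spanImage hi hη
    rwa [MonoidAlgebra.antipode_single, CommSemiring.antipode_eq_id, LinearMap.id_apply] at this

lemma mem_groupElements (hi : IsHopfForm L i) {J : SubHopfAlgebra K H} {η : N} :
    η ∈ J.groupElements hi ↔ MonoidAlgebra.single η (1 : L) ∈ J.spanImage L i := Iff.rfl

/-- Each component of an element of the span is in the span; dividing by its nonzero coefficient
gives a group element there. -/
lemma spanImage_eq (hi : IsHopfForm L i) (J : SubHopfAlgebra K H) :
    J.spanImage L i = Submodule.span L
      ((fun η : N => MonoidAlgebra.single η (1 : L)) '' (J.groupElements hi : Set N)) := by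
  refine le_antisymm (fun z hz => ?_) (Submodule.span_le.2 ?_)
  · rw [← MonoidAlgebra.sum_coeff_single z]
    refine Submodule.sum_mem _ fun η hη => ?_
    have h0 : z.coeff η ≠ 0 := Finsupp.mem_support_iff.1 hη
    have hsmul : MonoidAlgebra.single η (z.coeff η) =
        z.coeff η • MonoidAlgebra.single η (1 : L) := by simp
    have h1 := J.single_coeff_mem hi hz η
    rw [hsmul] at h1 ⊢
    exact Submodule.smul_mem _ _
      (Submodule.subset_span ⟨η, (Submodule.smul_mem_iff _ h0).1 h1, rfl⟩)
  · rintro _ ⟨η, hη, rfl⟩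
    exact hη

lemma single_mem_span_iff (M : Subgroup N) (η : N) :
    MonoidAlgebra.single η (1 : L) ∈ Submodule.span L
      ((fun η : N => MonoidAlgebra.single η (1 : L)) '' (M : Set N)) ↔ η ∈ M := by
  classical
  refine ⟨fun h => ?_, fun h => Submodule.subset_span ⟨η, h, rfl⟩⟩
  by_contra hη
  have (z : MonoidAlgebra L N) (hz : z ∈ Submodule.span L
      ((fun η : N => MonoidAlgebra.single η (1 : L)) '' (M : Set N))) : z.coeff η = 0 := by
    induction hz using Submodule.span_induction with
    | mem x hx =>
      obtain ⟨θ, hθ, rfl⟩ := hx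
      have : θ ≠ η := fun h => hη (h ▸ hθ)
      simp [this]
    | zero => simp
    | add x y _ _ hx hy => rw [MonoidAlgebra.coeff_add, Finsupp.add_apply, hx, hy, add_zero]
    | smul l x _ hx => simp [hx]
  simpa using this _ h

variable {ψ : Gal(L/K) →* MulAut N}

/-- The image of `J` is fixed pointwise, so its `L`-span is stable under the semilinear twist. -/
lemma galoisTwist_mem_groupElements (hi : IsHopfForm L i)
    (hr : ∀ h, i h ∈ twistedGroupAlgebra ψ) (J : SubHopfAlgebra K H) (σ : Gal(L/K)) {η : N}
    (hη : η ∈ J.groupElements hi) : ψ σ η ∈ J.groupElements hi := by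
  have (z : MonoidAlgebra L N) (hz : z ∈ J.spanImage L i) :
      galoisTwist ψ σ z ∈ J.spanImage L i := by
    induction hz using Submodule.span_induction with
    | mem x hx =>
      obtain ⟨y, hy, rfl⟩ := hx
      rw [hr y σ]
      exact J.mem_spanImage hy
    | zero => simp
    | add x y _ _ hx hy => rw [map_add]; exact add_mem hx hy
    | smul l x _ hx => rw [galoisTwist_smul]; exact Submodule.smul_mem _ _ hx
  have h := this _ hη
  rwa [galoisTwist_single, map_one] at h

lemma galoisTwist_mem_span {M : Subgroup N} (hM : ∀ σ, ∀ η ∈ M, ψ σ η ∈ M) (σ : Gal(L/K))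
    {z : MonoidAlgebra L N} (hz : z ∈ Submodule.span L
      ((fun η : N => MonoidAlgebra.single η (1 : L)) '' (M : Set N))) :
    galoisTwist ψ σ z ∈ Submodule.span L
      ((fun η : N => MonoidAlgebra.single η (1 : L)) '' (M : Set N)) := by
  induction hz using Submodule.span_induction with
  | mem x hx =>
    obtain ⟨η, hη, rfl⟩ := hx
    rw [galoisTwist_single, map_one]
    exact Submodule.subset_span ⟨_, hM σ η hη, rfl⟩
  | zero => simp
  | add x y _ _ hx hy => rw [map_add]; exact add_mem hx hy
  | smul l x _ hx => rw [galoisTwist_smul]; exact Submodule.smul_mem _ _ hx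

variable [FiniteDimensional K L] [IsGalois K L]

/-- A Galois stable subgroup of `N` defines a sub-Hopf algebra of a form of `L[N]`. -/
lemma exists_spanImage_eq (hi : IsHopfForm L i) (hr : i.range = twistedGroupAlgebra ψ)
    (M : Subgroup N) (hM : ∀ σ, ∀ η ∈ M, ψ σ η ∈ M) :
    ∃ J : SubHopfAlgebra K H, J.spanImage L i = Submodule.span L
      ((fun η : N => MonoidAlgebra.single η (1 : L)) '' (M : Set N)) := by
  set B := Submodule.span L ((fun η : N => MonoidAlgebra.single η (1 : L)) '' (M : Set N)) with hBdef
  -- Descent inside `B`: `z` is an `L`-combination of traces of the `d k • z`, which lie in `B` by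
  -- stability and in the range of `i` because they are fixed.
  have hB : B ≤ Submodule.span L (i '' (i ⁻¹' B)) := fun z hz => by
    obtain ⟨n, e, d, hed⟩ := exists_galois_coordinates K L
    rw [eq_sum_smul_trace (galoisTwistRep ψ) (galoisTwist_smul ψ) hed z]
    refine Submodule.sum_mem _ fun k _ => Submodule.smul_mem _ _ ?_
    have h1 : ∑ σ, galoisTwist ψ σ (d k • z) ∈ i.range := hr ▸ sum_galoisTwist_mem ψ _
    obtain ⟨x, hx⟩ := h1
    have hxB : i x ∈ B := hx ▸ Submodule.sum_mem _ fun σ _ =>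
      galoisTwist_mem_span hM σ (Submodule.smul_mem _ _ hz)
    exact Submodule.subset_span ⟨x, hxB, hx⟩
  refine ⟨SubHopfAlgebra.ofSubmodule hi B (Submodule.subset_span ⟨1, M.one_mem, rfl⟩) ?_ ?_ ?_ hB,
    le_antisymm ?_ hB⟩
  · intro a ha b hb
    have h := Submodule.mul_mem_mul ha hb
    rw [Submodule.span_mul_span] at h
    refine Submodule.span_mono ?_ h
    rintro _ ⟨_, ⟨η, hη, rfl⟩, _, ⟨θ, hθ, rfl⟩, rfl⟩
    exact ⟨η * θ, M.mul_mem hη hθ, by simp⟩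
  · intro a ha
    induction ha using Submodule.span_induction with
    | mem x hx =>
      obtain ⟨η, hη, rfl⟩ := hx
      exact Submodule.subset_span ⟨η⁻¹, M.inv_mem hη, by simp⟩
    | zero => simp
    | add x y _ _ hx hy => rw [map_add]; exact add_mem hx hy
    | smul l x _ hx => rw [map_smul]; exact Submodule.smul_mem _ l hx
  · intro a ha
    induction ha using Submodule.span_induction with
    | mem x hx =>
      obtain ⟨η, hη, rfl⟩ := hx
      have hηB : MonoidAlgebra.single η (1 : L) ∈ B := Submodule.subset_span ⟨η, hη, rfl⟩
      exact ⟨⟨_, hηB⟩ ⊗ₜ ⟨_, hηB⟩, by simp⟩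
    | zero => simp
    | add x y _ _ hx hy => rw [map_add]; exact add_mem hx hy
    | smul l x _ hx => rw [map_smul]; exact Submodule.smul_mem _ l hx
  · refine Submodule.span_le.2 ?_
    rintro _ ⟨x, hx, rfl⟩
    exact hx

/-- The sub-Hopf algebras of a form of `L[N]` correspond to the Galois stable subgroups of `N`. -/
noncomputable def equivStableSubgroup (hi : IsHopfForm L i)
    (hr : i.range = twistedGroupAlgebra ψ) :
    SubHopfAlgebra K H ≃ {M : Subgroup N // ∀ σ, ∀ η ∈ M, ψ σ η ∈ M} :=
  Equiv.ofBijective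
    (fun J => ⟨J.groupElements hi, fun σ _ hη =>
      J.galoisTwist_mem_groupElements hi (fun h => hr ▸ ⟨h, rfl⟩) σ hη⟩)
    -- The subgroup determines the span, and `J` is the part of `H` that `i` maps into its span.
    ⟨fun J J' h => by
      have hM : J.groupElements hi = J'.groupElements hi := congrArg Subtype.val h
      have hspan : J.spanImage L i = J'.spanImage L i := by
        rw [spanImage_eq hi, spanImage_eq hi, hM]
      have hsub : J.toSubalgebra = J'.toSubalgebra := le_antisymm
        (fun x hx => hi.isBaseChange.mem_of_mem_span
          (J := Subalgebra.toSubmodule J'.toSubalgebra)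
          (show i x ∈ J'.spanImage L i from hspan ▸ J.mem_spanImage hx))
        (fun x hx => hi.isBaseChange.mem_of_mem_span
          (J := Subalgebra.toSubmodule J.toSubalgebra)
          (show i x ∈ J.spanImage L i from hspan ▸ J'.mem_spanImage hx))
      exact SubHopfAlgebra.ext (congrArg (fun S : Subalgebra K H => (S : Set H)) hsub),
    fun M => by
      obtain ⟨J, hJ⟩ := exists_spanImage_eq hi hr M.1 M.2
      refine ⟨J, Subtype.ext (Subgroup.ext fun η => ?_)⟩
      rw [mem_groupElements, hJ, single_mem_span_iff]⟩

lemma equivStableSubgroup_apply (hi : IsHopfForm L i)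
    (hr : i.range = twistedGroupAlgebra ψ) (J : SubHopfAlgebra K H) :
    (equivStableSubgroup hi hr J : Subgroup N) = J.groupElements hi := rfl

end SubHopfAlgebra

/-! ### Left translations and the skew left brace. -/

/-- A group of permutations of `Γ` that is normalised by the left translations is acted on by `Γ`. -/
lemma exists_conjugation_action {Γ : Type*} [Group Γ] {N : Subgroup (Equiv.Perm Γ)}
    (h : ∀ σ, ∀ η ∈ N, MulAction.toPermHom Γ Γ σ * η * (MulAction.toPermHom Γ Γ σ)⁻¹ ∈ N) :
    ∃ ψ : Γ →* MulAut N, ∀ σ (η : N) γ,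
      (ψ σ η : Equiv.Perm Γ) (σ * γ) = σ * (η : Equiv.Perm Γ) γ := by
  refine ⟨N.normalizerMonoidHom.comp ((MulAction.toPermHom Γ Γ).codRestrict
    (Subgroup.normalizer (N : Set (Equiv.Perm Γ))) fun σ => ?_), fun σ η γ => ?_⟩
  -- The reverse implication is the hypothesis for `σ⁻¹`.
  · refine Subgroup.mem_normalizer_iff.2 fun η => ⟨h σ η, fun hη => ?_⟩
    simpa only [map_inv, mul_assoc, inv_mul_cancel_left, inv_inv, inv_mul_cancel, mul_one] using
      h σ⁻¹ _ hη
  · change σ * (η : Equiv.Perm Γ) (σ⁻¹ * (σ * γ)) = _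
    rw [inv_mul_cancel_left]

namespace SkewLeftBrace

variable {G Γ : Type*} [SkewLeftBrace G] [Group Γ] (a : Circ G ≃* Γ)

lemma alpha_apply (g k : G) : alpha a g (a (toCirc G k)) = a (toCirc G (g * k)) := by
  change a (toCirc G (g * (toCirc G).symm (a.symm (a (toCirc G k))))) = _
  simp

lemma toCirc_circ (g h : G) : toCirc G (circ g h) = toCirc G g * toCirc G h := rfl

lemma circ_mul' (g h k : G) : circ g (h * k) = circ g h * g⁻¹ * circ g k := circ_mul g h k

lemma exists_eq_toCirc (γ : Γ) : ∃ k : G, a (toCirc G k) = γ :=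
  ⟨(toCirc G).symm (a.symm γ), by simp⟩

/-- With `γ = a(k)`, this is the brace identity `h ∘ (g ⋆ k) = (h ∘ g) ⋆ h⁻¹ ⋆ (h ∘ k)` transported
by `a`. -/
lemma translation_alpha (h g : G) (γ : Γ) :
    alpha a (circ h g * h⁻¹) (a (toCirc G h) * γ) = a (toCirc G h) * alpha a g γ := by
  obtain ⟨k, rfl⟩ := exists_eq_toCirc a γ
  rw [alpha_apply, ← map_mul a, ← map_mul a, ← toCirc_circ, ← toCirc_circ, alpha_apply, circ_mul']

lemma translation_conj_alpha (h g : G) :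
    MulAction.toPermHom Γ Γ (a (toCirc G h)) * alpha a g *
      (MulAction.toPermHom Γ Γ (a (toCirc G h)))⁻¹ = alpha a (circ h g * h⁻¹) := by
  rw [mul_inv_eq_iff_eq_mul]
  ext γ
  exact (translation_alpha a h g γ).symm

lemma alpha_injective : Function.Injective (alpha a) := fun g h hgh => by
  have := congrArg (fun f : Equiv.Perm Γ => f (a (toCirc G 1))) hgh
  simpa [alpha_apply] using this

lemma bijective_alpha_range :
    Function.Bijective fun η : (alpha a).range => (η : Equiv.Perm Γ)⁻¹ 1 := by
  -- Here `k` is the identity of `(G, ∘)`; the argument does not need it to be the identity of `(G,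
  -- ⋆)`.
  obtain ⟨k, hk⟩ := exists_eq_toCirc a 1
  have key (g : G) : (alpha a g)⁻¹ 1 = a (toCirc G (g⁻¹ * k)) := by
    rw [← map_inv, ← hk, alpha_apply]
  refine ⟨?_, fun γ => ?_⟩
  · rintro ⟨_, g, rfl⟩ ⟨_, h, rfl⟩ hgh
    simp only [key] at hgh
    have : g = h := by simpa using hgh
    subst this
    rfl
  · obtain ⟨l, rfl⟩ := exists_eq_toCirc a γ
    refine ⟨⟨_, k * l⁻¹, rfl⟩, ?_⟩
    simp only [key]
    simp

/-- The `∘`-stable subgroups of `(G, ⋆)` are the subgroups of `α(G)` that are stable under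
conjugation by the left translations of `Γ`. -/
lemma exists_equiv_circStable {ψ : Γ →* MulAut (alpha a).range}
    (hψ : ∀ σ (η : (alpha a).range) γ,
      (ψ σ η : Equiv.Perm Γ) (σ * γ) = σ * (η : Equiv.Perm Γ) γ) :
    ∃ e : {M : Subgroup (alpha a).range // ∀ σ, ∀ η ∈ M, ψ σ η ∈ M} ≃
      {G' : Subgroup G // IsCircStable G'},
      ∀ M, (alpha a).rangeRestrict '' ((e M : Subgroup G) : Set G) =
        ((M : Subgroup (alpha a).range) : Set (alpha a).range) := by
  let β : G ≃* (alpha a).range := MonoidHom.ofInjective (alpha_injective a)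
  -- Through `β`, the conjugation action becomes `g ↦ (h ∘ g) ⋆ h⁻¹`, the expression in
  -- `IsCircStable`.
  have hβ (h g : G) : ψ (a (toCirc G h)) (β g) = β (circ h g * h⁻¹) := by
    refine Subtype.ext (Equiv.ext fun γ => ?_)
    rw [← mul_inv_cancel_left (a (toCirc G h)) γ, hψ]
    exact (translation_alpha a h g _).symm
  refine ⟨β.comapSubgroup.toEquiv.subtypeEquiv fun M => ⟨fun h g g' hg => ?_, fun h σ η hη => ?_⟩,
    fun M => ?_⟩
  · change β _ ∈ M
    rw [← hβ]
    exact h _ _ hg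
  · obtain ⟨k, rfl⟩ := exists_eq_toCirc a σ
    obtain ⟨g, rfl⟩ := β.surjective η
    rw [hβ]
    exact h k g hη
  · exact Set.image_preimage_eq _ β.surjective

end SkewLeftBrace

lemma map_iso_baseChange {K L H A : Type*} [Field K] [Field L] [Algebra K L] [Ring H]
    [HopfAlgebra K H] [Ring A] [Algebra K A] [HopfAlgebra L A] (J : SubHopfAlgebra K H)
    (e : L ⊗[K] H ≃ₐc[L] A) {i : H →ₐ[K] A} (hi : ∀ h, i h = e (1 ⊗ₜ h)) :
    (Submodule.baseChange L (Subalgebra.toSubmodule J.toSubalgebra)).map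
      (e : L ⊗[K] H →ₗ[L] A) = J.spanImage L i := by
  rw [Submodule.baseChange_eq_span, Submodule.map_span, SubHopfAlgebra.spanImage]
  congr 1
  ext z
  constructor
  · rintro ⟨_, ⟨x, hx, rfl⟩, rfl⟩
    exact ⟨x, hx, hi x⟩
  · rintro ⟨x, hx, rfl⟩
    exact ⟨_, ⟨x, hx, rfl⟩, (hi x).symm⟩

theorem theorem4p3 {K : Type u} {L : Type v} {G : Type w} [Field K] [Field L] [Algebra K L]
    [IsGalois K L] [Finite G] [SkewLeftBrace G] (a : SkewLeftBrace.Circ G ≃* Gal(L/K)) :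
    -- the Hopf Galois structure that corresponds to `a` exists
    (∃ (H : Type v) (_ : Ring H) (_ : HopfAlgebra K H) (_ : Coalgebra.IsCocomm K H)
      (S : HopfGaloisStructure K L H), Nonempty (S.Correspondence (SkewLeftBrace.alpha a).range)) ∧
    -- it is unique up to isomorphism
    (∀ (H₁ : Type x) (H₂ : Type y) [Ring H₁] [HopfAlgebra K H₁] [Coalgebra.IsCocomm K H₁]
      [Ring H₂] [HopfAlgebra K H₂] [Coalgebra.IsCocomm K H₂]
      (S₁ : HopfGaloisStructure K L H₁) (S₂ : HopfGaloisStructure K L H₂),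
      Nonempty (S₁.Correspondence (SkewLeftBrace.alpha a).range) →
      Nonempty (S₂.Correspondence (SkewLeftBrace.alpha a).range) →
      ∃ e : H₁ ≃ₐc[K] H₂, ∀ h : H₁, S₂.action (e h) = S₁.action h) ∧
    -- the bijection, where `J` goes to `G'` when `L ⊗ J` is `L[α(G')]` in `L ⊗ H ≅ L[α(G)]`
    (∀ (H : Type x) [Ring H] [HopfAlgebra K H] [Coalgebra.IsCocomm K H]
      (S : HopfGaloisStructure K L H) (C : S.Correspondence (SkewLeftBrace.alpha a).range),
      ∃ Φ : SubHopfAlgebra K H ≃ {G' : Subgroup G // SkewLeftBrace.IsCircStable G'},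
        ∀ J : SubHopfAlgebra K H,
          (Submodule.baseChange L (Subalgebra.toSubmodule J.toSubalgebra)).map
              (C.iso : L ⊗[K] H →ₗ[L] MonoidAlgebra L (SkewLeftBrace.alpha a).range) =
            Submodule.span L
              ((fun g : G => MonoidAlgebra.single ((SkewLeftBrace.alpha a).rangeRestrict g) (1 : L)) ''
                ((Φ J : Subgroup G) : Set G))) := by

  -- Finiteness of `L/K` is deduced from that of `G`.
  have : Finite Gal(L/K) := Finite.of_equiv G ((SkewLeftBrace.toCirc G).trans a.toEquiv)
  have : FiniteDimensional K L := IsGalois.finiteDimensional_of_finite K L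
  obtain ⟨ψ, hψ⟩ := exists_conjugation_action (N := (SkewLeftBrace.alpha a).range) (by
    rintro σ _ ⟨g, rfl⟩
    obtain ⟨h, rfl⟩ := SkewLeftBrace.exists_eq_toCirc a σ
    exact ⟨_, (SkewLeftBrace.translation_conj_alpha a h g).symm⟩)
  have hN := SkewLeftBrace.bijective_alpha_range a
  refine ⟨?_, ?_, ?_⟩
  · obtain ⟨D⟩ := nonempty_hopfDescentData ψ
    let _ : HopfAlgebra K (twistedGroupAlgebra ψ) := D.hopfAlgebra
    have hi : IsHopfForm L (twistedGroupAlgebra ψ).val := D.isHopfForm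
    exact ⟨twistedGroupAlgebra ψ, inferInstance, D.hopfAlgebra, hi.isCocomm,
      hi.hopfGaloisStructure hψ (fun h => h.2) hN, ⟨hi.correspondence hψ (fun h => h.2) hN⟩⟩
  · intro H₁ H₂ _ _ _ _ _ _ S₁ S₂ ⟨C₁⟩ ⟨C₂⟩
    obtain ⟨e, he⟩ := C₁.isHopfForm_embedding.exists_equiv C₂.isHopfForm_embedding
      ((C₁.range_embedding hψ hN.1).trans (C₂.range_embedding hψ hN.1).symm)
    refine ⟨e, fun h => LinearMap.ext fun y => ?_⟩
    -- Both actions are evaluations of the same element of `L[N]`.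
    rw [← C₂.groupAlgebraEval_embedding, he, C₁.groupAlgebraEval_embedding]
  · intro H _ _ _ S C
    obtain ⟨e, he⟩ := SkewLeftBrace.exists_equiv_circStable a hψ
    refine ⟨(SubHopfAlgebra.equivStableSubgroup C.isHopfForm_embedding
      (C.range_embedding hψ hN.1)).trans e, fun J => ?_⟩
    rw [map_iso_baseChange J C.iso C.embedding_apply, J.spanImage_eq C.isHopfForm_embedding,
      Equiv.trans_apply, ← SubHopfAlgebra.equivStableSubgroup_apply C.isHopfForm_embedding
        (C.range_embedding hψ hN.1), ← he, Set.image_image]
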